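/- Let $G$ be an abelian group and let $k$ be a commutative $G$-ring, i.e. a unital commutative ring with an action of $G$ by ring automorphisms, written $(g,\lambda)\mapsto g\lambda$. Let $n\ge 0$ be a natural number and let $\delta\in k$. A $G$-Brauer $n$-diagram is a graph on two columns of $n$ nodes in which every node is joined by an edge to exactly one other node, each edge being labelled by an element of $G$. The composite $x\cdot y$ of two such diagrams is obtained by identifying the right-hand nodes of $x$ with the left-hand nodes of $y$, forgetting the middle nodes, labelling each edge formed by concatenation with the product of the labels along it, and deleting all closed loops. The $G$-Brauer algebra $G\mathcal{B}_n(\delta)$ is the $k$-algebra of formal $k$-linear combinations of $G$-Brauer $n$-diagrams, whose multiplication is the $k$-bilinear extension of composition in which each deleted loop, with product of labels $g\in G$, contributes a factor $g\delta\in k$. The trivial (left or right) module $\mathbb{1}$ over $G\mathcal{B}_n(\delta)$ is a copy of $k$ on which diagrams without left-to-left and right-to-right connections act as multiplication by $1$ and all other diagrams act as $0$. Let $\Sigma_n$ act on $G^n$ by permuting the factors; over the (untwisted) group algebra $k[G^n\rtimes\Sigma_n]$, $\mathbb{1}$ denotes $k$ with every group element acting as $1$. **Theorem.** If $\delta\in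 k$ is invertible, there are isomorphisms of graded $k$-modules $$\mathrm{Tor}_{\star}^{G\mathcal{B}_n(\delta)}(\mathbb{1},\mathbb{1})\;\cong\;\mathrm{Tor}_{\star}^{k[G^n\rtimes\Sigma_n]}(\mathbb{1},\mathbb{1})\;\cong\;H_{\star}(G^n\rtimes\Sigma_n;k),$$ where the last term is group homology with trivial coefficients. In particular, if $G$ is the trivial group, so that $G\mathcal{B}_n(\delta)$ is the Brauer algebra $\mathcal{B}_n(\delta)$, then $$\mathrm{Tor}_{\star}^{\mathcal{B}_n(\delta)}(\mathbb{1},\mathbb{1})\;\cong\;H_{\star}(\Sigma_n;k).$$ -/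

import Mathlib

universe u

section Fibre

/-- The product of the values `ℓ e` over the fibre of `f` above `c` (used for finite `E`). -/
noncomputable def fibreProd {E C G : Type*} [CommMonoid G] (f : E → C) (ℓ : E → G) (c : C) : G :=
  ∏ᶠ e : {e : E // f e = c}, ℓ e

theorem fibreProd_congr {E F C D G : Type*} [CommMonoid G]
    {f : E → C} {ℓ : E → G} {f' : F → D} {ℓ' : F → G}
    (σ : E ≃ F) (c : C) (d : D) (h : ∀ e, f e = c ↔ f' (σ e) = d) (hℓ : ∀ e, ℓ' (σ e) = ℓ e) :
    fibreProd f ℓ c = fibreProd f' ℓ' d := by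
  unfold fibreProd
  exact finprod_eq_of_bijective (σ.subtypeEquiv h) (Equiv.bijective _) (fun e => (hℓ e).symm)

theorem fibreProd_eq_prod {E C G : Type*} [CommMonoid G] [Fintype E] [DecidableEq C]
    (f : E → C) (ℓ : E → G) (c : C) :
    fibreProd f ℓ c = ∏ e, if f e = c then ℓ e else 1 := by
  unfold fibreProd
  rw [finprod_eq_prod_of_fintype, ← Finset.prod_filter]
  exact (Finset.prod_subtype _ (by simp) ℓ).symm

theorem fibreProd_comp {E C D G : Type*} [CommMonoid G] [Finite E] [Finite C]
    (f : E → C) (g : C → D) (ℓ : E → G) (d : D) :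
    fibreProd (fun e => g (f e)) ℓ d = fibreProd g (fibreProd f ℓ) d := by
  classical
  have := Fintype.ofFinite E
  have := Fintype.ofFinite C
  have key (x : C) : (if g x = d then fibreProd f ℓ x else 1) =
      ∏ e, if f e = x then (if g (f e) = d then ℓ e else 1) else 1 := by
    rw [fibreProd_eq_prod]
    by_cases h : g x = d
    · rw [if_pos h]
      refine Finset.prod_congr rfl fun e _ => ?_
      by_cases h' : f e = x
      · rw [if_pos h', if_pos h', h', if_pos h]
      · rw [if_neg h', if_neg h']
    · rw [if_neg h]
      refine (Finset.prod_eq_one fun e _ => ?_).symm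
      by_cases h' : f e = x
      · rw [if_pos h', h', if_neg h]
      · rw [if_neg h']
  rw [fibreProd_eq_prod g, Finset.prod_congr rfl (fun x _ => key x), Finset.prod_comm,
    fibreProd_eq_prod]
  simp

theorem fibreProd_sum {E F C G : Type*} [CommMonoid G] [Finite E] [Finite F]
    (f : E ⊕ F → C) (ℓ : E ⊕ F → G) (c : C) :
    fibreProd f ℓ c = fibreProd (fun e => f (.inl e)) (fun e => ℓ (.inl e)) c *
      fibreProd (fun e => f (.inr e)) (fun e => ℓ (.inr e)) c := by
  classical
  have := Fintype.ofFinite E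
  have := Fintype.ofFinite F
  simp_rw [fibreProd_eq_prod, Fintype.prod_sum_type]

theorem fibreProd_of_injective {E C G : Type*} [CommMonoid G]
    (f : E → C) (hf : Function.Injective f) (ℓ : E → G) (e : E) :
    fibreProd f ℓ (f e) = ℓ e := by
  unfold fibreProd
  rw [finprod_eq_single _ (⟨e, rfl⟩ : {e' : E // f e' = f e})]
  exact fun x hx => absurd (Subtype.ext (hf x.2)) hx

theorem fibreProd_of_isEmpty {E C G : Type*} [CommMonoid G]
    (f : E → C) (ℓ : E → G) (c : C) (h : ∀ e, f e ≠ c) :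
    fibreProd f ℓ c = 1 := by
  have : IsEmpty {e : E // f e = c} := ⟨fun e => h _ e.2⟩
  exact finprod_of_isEmpty _

end Fibre

/-- For two involutions of a finite set, the first without fixed points, the orbit of a fixed point
of the second contains exactly one further fixed point of the second. -/
theorem exists_other_fixed {V : Type*} [Finite V] (p q : V → V) (hp : ∀ v, p (p v) = v)
    (hq : ∀ v, q (q v) = v) (hfix : ∀ v, p v ≠ v) (v : V) (hv : q v = v) :
    ∃ S : Set V, v ∈ S ∧ (∀ w, p w ∈ S ↔ w ∈ S) ∧ (∀ w, q w ∈ S ↔ w ∈ S) ∧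
      (∀ w ∈ S, ∀ T : Set V, v ∈ T → (∀ w, p w ∈ T ↔ w ∈ T) → (∀ w, q w ∈ T ↔ w ∈ T) → w ∈ T) ∧
      ∃ w ∈ S, w ≠ v ∧ q w = w ∧ ∀ w' ∈ S, q w' = w' → w' = v ∨ w' = w := by
  classical
  let P : Equiv.Perm V := ⟨p, p, hp, hp⟩
  let Q : Equiv.Perm V := ⟨q, q, hq, hq⟩
  let c := Q * P
  have hPP : P * P = 1 := Equiv.ext hp
  have hQQ : Q * Q = 1 := Equiv.ext hq
  have hPi : P⁻¹ = P := inv_eq_of_mul_eq_one_left hPP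
  have hQi : Q⁻¹ = Q := inv_eq_of_mul_eq_one_left hQQ
  have hQc (k : ℤ) : Q * c ^ k = c ^ (-k) * Q := by
    have h1 : Q * c * Q⁻¹ = c⁻¹ := by
      simp only [c, mul_inv_rev, hPi, hQi]
      rw [← mul_assoc, hQQ, one_mul]
    have h2 : Q * c ^ k * Q⁻¹ = c ^ (-k) := by
      rw [← conj_zpow, h1, inv_zpow']
    rw [← h2]; simp
  have hqc (k : ℤ) : q ((c ^ k) v) = (c ^ (-k)) v := by
    have := congrArg (fun f : Equiv.Perm V => f v) (hQc k)
    simpa [Equiv.Perm.mul_apply, Q, hv] using this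
  have hpq (w : V) : p w = q (c w) := by
    simp [c, P, Q, Equiv.Perm.mul_apply, hq]
  have hpc (k : ℤ) : p ((c ^ k) v) = (c ^ (-(k + 1))) v := by
    rw [← hqc, add_comm, zpow_add, zpow_one, Equiv.Perm.mul_apply, ← hpq]
  have hper (k : ℤ) : (c ^ k) v = v ↔ (MulAction.period c v : ℤ) ∣ k := by
    rw [← MulAction.zpow_smul_eq_iff_period_dvd, Equiv.Perm.smul_def]
  have hpos : 0 < MulAction.period c v :=
    MulAction.period_pos_of_orderOf_pos (isOfFinOrder_of_finite c).orderOf_pos v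
  have heq (i j : ℤ) : (c ^ i) v = (c ^ j) v ↔ (MulAction.period c v : ℤ) ∣ (i - j) := by
    rw [← hper, sub_eq_neg_add, zpow_add, Equiv.Perm.mul_apply, zpow_neg, Equiv.Perm.inv_eq_iff_eq]
  have hodd (k : ℤ) : ¬ (MulAction.period c v : ℤ) ∣ (2 * k + 1) := by
    intro h
    apply hfix ((c ^ k) v)
    rw [hpc, heq, show -(k + 1) - k = -(2 * k + 1) by ring, dvd_neg]
    exact h
  obtain ⟨m, hm⟩ : ∃ m : ℕ, MulAction.period c v = 2 * m := by
    rcases Nat.even_or_odd' (MulAction.period c v) with ⟨m, h | h⟩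
    · exact ⟨m, h⟩
    · exact absurd (by rw [h]; push_cast; exact dvd_rfl) (hodd m)
  rw [hm] at heq hpos
  have hcS (T : Set V) (h0 : v ∈ T) (h1 : ∀ w, p w ∈ T ↔ w ∈ T) (h2 : ∀ w, q w ∈ T ↔ w ∈ T)
      (k : ℤ) : (c ^ k) v ∈ T := by
    have hc (w : V) : c w ∈ T ↔ w ∈ T := by rw [← h2 (c w), ← hpq, h1]
    have hci (w : V) : c⁻¹ w ∈ T ↔ w ∈ T := by rw [← hc (c⁻¹ w)]; simp
    induction k with
    | zero => simpa using h0
    | succ i ih => rw [add_comm, zpow_add, Equiv.Perm.mul_apply, zpow_one, hc]; exact ih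
    | pred i ih =>
      rw [sub_eq_add_neg, add_comm, zpow_add, Equiv.Perm.mul_apply, zpow_neg_one, hci]; exact ih
  refine ⟨{w | ∃ k : ℤ, w = (c ^ k) v}, ⟨0, by simp⟩, ?_, ?_, ?_, (c ^ (m : ℤ)) v, ⟨m, rfl⟩, ?_, ?_, ?_⟩
  · have h : ∀ w, (∃ k : ℤ, w = (c ^ k) v) → ∃ k : ℤ, p w = (c ^ k) v := by
      rintro _ ⟨k, rfl⟩; exact ⟨_, hpc k⟩
    exact fun w => ⟨fun h' => by simpa [hp] using h _ h', h w⟩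
  · have h : ∀ w, (∃ k : ℤ, w = (c ^ k) v) → ∃ k : ℤ, q w = (c ^ k) v := by
      rintro _ ⟨k, rfl⟩; exact ⟨_, hqc k⟩
    exact fun w => ⟨fun h' => by simpa [hq] using h _ h', h w⟩
  · rintro _ ⟨k, rfl⟩ T h0 h1 h2
    exact hcS T h0 h1 h2 k
  · intro h
    have := (heq m 0).1 (by simpa using h)
    obtain ⟨t, ht⟩ := this
    push_cast at ht
    have hm0 : (m : ℤ) ≠ 0 := by omega
    have : (m : ℤ) * 1 = m * (2 * t) := by linarith
    have := mul_left_cancel₀ hm0 this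
    omega
  · rw [hqc, heq]
    exact ⟨-1, by push_cast; ring⟩
  · rintro _ ⟨k, rfl⟩ h
    rw [hqc, heq] at h
    obtain ⟨t, ht⟩ := h
    push_cast at ht
    have hk : k = -(m * t) := by linarith
    rcases Int.even_or_odd' t with ⟨s, rfl | rfl⟩
    · left
      have := (heq k 0).2 ⟨-s, by rw [hk]; push_cast; ring⟩
      simpa using this
    · right
      rw [heq]
      exact ⟨-s - 1, by rw [hk]; push_cast; ring⟩

section Gluing

theorem fibreProd_one {E C G : Type*} [CommMonoid G] (f : E → C) (ℓ : E → G) (c : C)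
    (h : ∀ e, ℓ e = 1) : fibreProd f ℓ c = 1 := by
  unfold fibreProd
  simp [h]

theorem finprod_sum_type {E F M : Type*} [CommMonoid M] [Finite E] [Finite F] (f : E ⊕ F → M) :
    ∏ᶠ e, f e = (∏ᶠ e, f (.inl e)) * ∏ᶠ e, f (.inr e) := by
  have := Fintype.ofFinite E
  have := Fintype.ofFinite F
  simp_rw [finprod_eq_prod_of_fintype, Fintype.prod_sum_type]

/-- Gluing `E` to `F` in two stages: the quotient of `E ⊕ F` by a relation `r` on `E` together with
`a' i ∼ b i` agrees with first forming `Quot r`, splitting off the classes outside `range j`, and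
then gluing the rest to `F`. -/
theorem glue_two_stages {E F D I B Q2 Q3 G k : Type*} [CommMonoid G] [CommMonoid k]
    [Finite E] [Finite F] [Finite D]
    (r : E → E → Prop) (j : D → Quot r) (hj : Function.Injective j)
    (a : I → D) (a' : I → E) (ha : ∀ i, j (a i) = Quot.mk r (a' i)) (b : I → F)
    (m2 : D ⊕ F → Q2) (hs2 : Function.Surjective m2)
    (hm2 : ∀ i, m2 (.inl (a i)) = m2 (.inr (b i)))
    (hU2 : ∀ f : D ⊕ F → Q3, (∀ i, f (.inl (a i)) = f (.inr (b i))) →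
      ∃ g : Q2 → Q3, ∀ e, g (m2 e) = f e)
    (m3 : E ⊕ F → Q3) (hs3 : Function.Surjective m3)
    (hr3 : ∀ e e', r e e' → m3 (.inl e) = m3 (.inl e'))
    (hm3 : ∀ i, m3 (.inl (a' i)) = m3 (.inr (b i)))
    (hU3 : ∀ f : E ⊕ F → Q2 ⊕ {p : Quot r // p ∉ Set.range j},
      (∀ e e', r e e' → f (.inl e) = f (.inl e')) →
      (∀ i, f (.inl (a' i)) = f (.inr (b i))) →
      ∃ g : Q3 → Q2 ⊕ {p : Quot r // p ∉ Set.range j}, ∀ e, g (m3 e) = f e)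
    (ℓE : E → G) (ℓF : F → G)
    (β : B → D ⊕ F) (β3 : B → E ⊕ F)
    (hβ : ∀ u, (∃ d e, β u = .inl d ∧ β3 u = .inl e ∧ j d = Quot.mk r e) ∨
      ∃ f, β u = .inr f ∧ β3 u = .inr f) (w : G → k) :
    let ℓ2 : D ⊕ F → G := Sum.elim (fun d => fibreProd (Quot.mk r) ℓE (j d)) ℓF
    let ℓ3 : E ⊕ F → G := Sum.elim ℓE ℓF
    (∀ u v, m2 (β u) = m2 (β v) ↔ m3 (β3 u) = m3 (β3 v)) ∧
    (∀ u, fibreProd m2 ℓ2 (m2 (β u)) = fibreProd m3 ℓ3 (m3 (β3 u))) ∧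
    (∏ᶠ c : {c // c ∉ Set.range (fun u => m3 (β3 u))}, w (fibreProd m3 ℓ3 c)) =
      (∏ᶠ c : {c // c ∉ Set.range (fun u => m2 (β u))}, w (fibreProd m2 ℓ2 c)) *
      ∏ᶠ p : {p : Quot r // p ∉ Set.range j}, w (fibreProd (Quot.mk r) ℓE p) := by
  classical
  intro ℓ2 ℓ3
  have : Finite (Quot r) := Finite.of_surjective _ Quot.mk_surjective
  have : Finite Q2 := Finite.of_surjective _ hs2
  let h : Quot r → Q2 ⊕ {p : Quot r // p ∉ Set.range j} := fun p =>
    if hp : p ∈ Set.range j then .inl (m2 (.inl hp.choose)) else .inr ⟨p, hp⟩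
  have hh1 (d : D) : h (j d) = .inl (m2 (.inl d)) := by
    have hp : j d ∈ Set.range j := ⟨d, rfl⟩
    simp only [h, dif_pos hp]
    rw [hj hp.choose_spec]
  have hh2 (p) (hp : p ∉ Set.range j) : h p = .inr ⟨p, hp⟩ := by
    simp only [h, dif_neg hp]
  obtain ⟨θ, hθ⟩ := hU3 (Sum.elim (fun e => h (Quot.mk r e)) (fun f => .inl (m2 (.inr f))))
    (fun e e' he => by simp only [Sum.elim_inl]; rw [Quot.sound he])
    (fun i => by simp only [Sum.elim_inl, Sum.elim_inr]; rw [← ha, hh1, hm2])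
  have hθl (e : E) : θ (m3 (.inl e)) = h (Quot.mk r e) := hθ _
  have hθr (f : F) : θ (m3 (.inr f)) = .inl (m2 (.inr f)) := hθ _
  let t : Quot r → Q3 := Quot.lift (fun e => m3 (.inl e)) hr3
  have ht (e) : t (Quot.mk r e) = m3 (.inl e) := rfl
  obtain ⟨g, hg⟩ := hU2 (Sum.elim (fun d => t (j d)) (fun f => m3 (.inr f)))
    (fun i => by simp only [Sum.elim_inl, Sum.elim_inr]; rw [ha, ht, hm3])
  have hgl (d : D) : g (m2 (.inl d)) = t (j d) := hg _
  have hgr (f : F) : g (m2 (.inr f)) = m3 (.inr f) := hg _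
  let τ : Q2 ⊕ {p : Quot r // p ∉ Set.range j} → Q3 := Sum.elim g (fun p => t p)
  have hτh (p) : τ (h p) = t p := by
    by_cases hp : p ∈ Set.range j
    · obtain ⟨d, rfl⟩ := hp
      rw [hh1]; exact hgl d
    · rw [hh2 p hp]; rfl
  have hθt (p) : θ (t p) = h p := by
    obtain ⟨e, rfl⟩ := Quot.mk_surjective p
    exact hθl e
  have hτθ (c) : τ (θ c) = c := by
    obtain ⟨e | f, rfl⟩ := hs3 c
    · rw [hθl, hτh]
    · rw [hθr]; exact hgr f
  have hθτ (c) : θ (τ c) = c := by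
    rcases c with q | p
    · obtain ⟨d | f, rfl⟩ := hs2 q
      · change θ (g _) = _
        rw [hgl, hθt, hh1]
      · change θ (g _) = _
        rw [hgr, hθr]
    · change θ (t p) = _
      rw [hθt, hh2 p p.2]
  have hinj : Function.Injective θ := Function.LeftInverse.injective hτθ
  have hθβ (u : B) : θ (m3 (β3 u)) = .inl (m2 (β u)) := by
    rcases hβ u with ⟨d, e, h1, h2, h3⟩ | ⟨f, h1, h2⟩
    · rw [h1, h2, hθl, ← h3, hh1]
    · rw [h1, h2, hθr]
  have hl1 (q : Q2) : fibreProd m2 ℓ2 q = fibreProd m3 ℓ3 (τ (.inl q)) := by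
    rw [fibreProd_sum, fibreProd_sum m3]
    congr 1
    · have e1 : fibreProd (fun e => m3 (.inl e)) (fun e => ℓ3 (.inl e)) (τ (.inl q)) =
          fibreProd (fun e => h (Quot.mk r e)) ℓE (.inl q) := by
        refine fibreProd_congr (Equiv.refl _) _ _ (fun e => ?_) (fun e => rfl)
        rw [Equiv.refl_apply, ← hθl]
        exact ⟨fun H => by rw [H, hθτ], fun H => by rw [← H, hτθ]⟩
      rw [e1, fibreProd_comp (Quot.mk r) h]
      unfold fibreProd
      refine finprod_eq_of_bijective (fun d : {d : D // m2 (.inl d) = q} =>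
        (⟨j d.1, by rw [hh1, d.2]⟩ : {p : Quot r // h p = .inl q})) ⟨?_, ?_⟩ (fun d => rfl)
      · intro d d' hd
        exact Subtype.ext (hj (congrArg Subtype.val hd))
      · rintro ⟨p, hp⟩
        by_cases hpj : p ∈ Set.range j
        · obtain ⟨d, rfl⟩ := hpj
          rw [hh1] at hp
          exact ⟨⟨d, Sum.inl_injective hp⟩, rfl⟩
        · rw [hh2 p hpj] at hp
          cases hp
    · refine fibreProd_congr (Equiv.refl _) _ _ (fun f => ?_) (fun f => rfl)
      rw [Equiv.refl_apply]
      constructor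
      · intro H
        rw [← H]
        exact (hgr f).symm
      · intro H
        have := hθr f
        rw [H, hθτ] at this
        exact (Sum.inl_injective this).symm
  have hl2 (p : {p : Quot r // p ∉ Set.range j}) :
      fibreProd (Quot.mk r) ℓE p = fibreProd m3 ℓ3 (τ (.inr p)) := by
    rw [fibreProd_sum m3, fibreProd_of_isEmpty (fun e => m3 (.inr e)), mul_one]
    · refine fibreProd_congr (Equiv.refl _) _ _ (fun e => ?_) (fun e => rfl)
      rw [Equiv.refl_apply]
      constructor
      · intro H
        rw [← ht, H]; rfl
      · intro H
        have := hθl e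
        rw [H, hθτ] at this
        by_cases hpj : Quot.mk r e ∈ Set.range j
        · obtain ⟨d, hd⟩ := hpj
          rw [← hd, hh1] at this
          cases this
        · rw [hh2 _ hpj] at this
          exact (congrArg Subtype.val (Sum.inr_injective this)).symm
    · intro f H
      have := hθr f
      rw [H, hθτ] at this
      cases this
  refine ⟨fun u v => ?_, fun u => ?_, ?_⟩
  · rw [← hinj.eq_iff, hθβ, hθβ, Sum.inl_injective.eq_iff]
  · rw [hl1, ← hθβ, hτθ]
  · refine Eq.trans ?_ (finprod_sum_type (fun c : {c // c ∉ Set.range (fun u => m2 (β u))} ⊕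
      {p : Quot r // p ∉ Set.range j} =>
        Sum.elim (fun c => w (fibreProd m2 ℓ2 c.1)) (fun p => w (fibreProd (Quot.mk r) ℓE p.1)) c))
    symm
    refine finprod_eq_of_bijective (Sum.elim (fun c => ⟨τ (.inl c.1), ?_⟩)
      (fun p => ⟨τ (.inr p), ?_⟩)) ⟨?_, ?_⟩ ?_
    · rintro ⟨u, hu⟩
      have hu' := congrArg θ hu
      simp only [hθτ, hθβ] at hu'
      exact c.2 ⟨u, Sum.inl_injective hu'⟩
    · rintro ⟨u, hu⟩
      have hu' := congrArg θ hu
      simp only [hθτ, hθβ] at hu'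
      cases hu'
    · have hτinj : Function.Injective τ := Function.LeftInverse.injective hθτ
      rintro (c | p) (c' | p') H
      · exact congrArg _ (Subtype.ext (Sum.inl_injective (hτinj (congrArg Subtype.val H))))
      · have H' : τ (.inl c.1) = τ (.inr p') := congrArg Subtype.val H
        cases hτinj H'
      · have H' : τ (.inr p) = τ (.inl c'.1) := congrArg Subtype.val H
        cases hτinj H'
      · exact congrArg _ (Sum.inr_injective (hτinj (congrArg Subtype.val H)))
    · rintro ⟨c, hc⟩
      rcases hcc : θ c with q | p
      · refine ⟨.inl ⟨q, ?_⟩, ?_⟩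
        · rintro ⟨u, hu⟩
          refine hc ⟨u, hinj ?_⟩
          simp only [hθβ, hcc, hu]
        · apply Subtype.ext
          simp only [Sum.elim_inl]
          rw [← hcc, hτθ]
      · refine ⟨.inr p, ?_⟩
        apply Subtype.ext
        simp only [Sum.elim_inr]
        rw [← hcc, hτθ]
    · rintro (c | p)
      · exact congrArg w (hl1 _)
      · exact congrArg w (hl2 _)

end Gluing

/-! ### Labelled Brauer diagrams -/

/-- The `2n` nodes of an `n`-diagram: `Sum.inl i` is the `i`-th node of the left-hand column and
`Sum.inr i` is the `i`-th node of the right-hand column. -/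
abbrev BrauerNode (n : ℕ) : Type := Fin n ⊕ Fin n

/-- A `G`-Brauer `n`-diagram: a graph on two columns of `n` nodes in which every node is joined by
an edge to exactly one other node, each edge carrying a label in `G`.  Here `partner v` is the node
joined to `v` and `label v` is the label of the edge at `v`. -/
@[ext]
structure GBrauerDiagram (G : Type u) (n : ℕ) where
  partner : BrauerNode n → BrauerNode n
  label : BrauerNode n → G
  partner_partner : ∀ v, partner (partner v) = v
  partner_ne : ∀ v, partner v ≠ v
  label_partner : ∀ v, label (partner v) = label v

namespace GBrauerDiagram

section Edges

variable {G : Type u} {n : ℕ}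

/-- Two nodes are equivalent when they are ends of the same edge. -/
def edgeSetoid (x : GBrauerDiagram G n) : Setoid (BrauerNode n) where
  r u v := u = v ∨ u = x.partner v
  iseqv :=
    { refl := fun _ => Or.inl rfl
      symm := by
        rintro u v (rfl | rfl)
        · exact Or.inl rfl
        · exact Or.inr (x.partner_partner _).symm
      trans := by
        rintro u v w (rfl | rfl) (rfl | rfl)
        · exact Or.inl rfl
        · exact Or.inr rfl
        · exact Or.inr rfl
        · exact Or.inl (x.partner_partner _) }

/-- The edges of a diagram. -/
def Edge (x : GBrauerDiagram G n) : Type := Quotient x.edgeSetoid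

instance (x : GBrauerDiagram G n) : Finite x.Edge := Quotient.finite _

/-- The edge at a node. -/
def edge (x : GBrauerDiagram G n) (v : BrauerNode n) : x.Edge := Quotient.mk _ v

theorem edge_eq_iff (x : GBrauerDiagram G n) (u v : BrauerNode n) :
    x.edge u = x.edge v ↔ u = v ∨ u = x.partner v := Quotient.eq

theorem edge_partner (x : GBrauerDiagram G n) (v : BrauerNode n) :
    x.edge (x.partner v) = x.edge v := (x.edge_eq_iff _ _).2 (Or.inr rfl)

theorem edge_surjective (x : GBrauerDiagram G n) : Function.Surjective x.edge :=
  Quotient.mk_surjective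

/-- The label of an edge. -/
def edgeLabel (x : GBrauerDiagram G n) : x.Edge → G :=
  Quotient.lift x.label (by rintro u v (rfl | rfl); exacts [rfl, x.label_partner _])

@[simp]
theorem edgeLabel_edge (x : GBrauerDiagram G n) (v : BrauerNode n) :
    x.edgeLabel (x.edge v) = x.label v := rfl

end Edges

section Composition

variable {G : Type u} {n : ℕ}

/-- In the concatenation of `x` and `y` the `i`-th right-hand node of `x` is identified with the
`i`-th left-hand node of `y`, so the edge of `x` and the edge of `y` at that node are joined. -/
inductive Joined (x y : GBrauerDiagram G n) : x.Edge ⊕ y.Edge → x.Edge ⊕ y.Edge → Prop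
  | middle (i : Fin n) :
      Joined x y (Sum.inl (x.edge (Sum.inr i))) (Sum.inr (y.edge (Sum.inl i)))

/-- The connected components of the concatenation of `x` and `y`: classes of edges of `x` and `y`
modulo being joined at a middle node. -/
abbrev Component (x y : GBrauerDiagram G n) : Type := Quot (Joined x y)

/-- The component of the concatenation containing a given outer node (a left-hand node of `x` or a
right-hand node of `y`). -/
def outer (x y : GBrauerDiagram G n) : BrauerNode n → Component x y :=
  Sum.elim (fun i => Quot.mk _ (Sum.inl (x.edge (Sum.inl i))))
    (fun i => Quot.mk _ (Sum.inr (y.edge (Sum.inr i))))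

/-- The label of a component of the concatenation: the product of the labels of its edges. -/
noncomputable def componentLabel [CommMonoid G] (x y : GBrauerDiagram G n) : Component x y → G :=
  fibreProd (Quot.mk (Joined x y)) (Sum.elim x.edgeLabel y.edgeLabel)

/-- Each component that contains an outer node contains exactly two of them. -/
theorem exists_unique_other_end (x y : GBrauerDiagram G n) (u : BrauerNode n) :
    ∃! v, v ≠ u ∧ outer x y v = outer x y u := by
  let p : BrauerNode n ⊕ BrauerNode n → BrauerNode n ⊕ BrauerNode n :=
    Sum.map x.partner y.partner
  let q : BrauerNode n ⊕ BrauerNode n → BrauerNode n ⊕ BrauerNode n :=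
    Sum.elim (Sum.elim (fun i => .inl (.inl i)) (fun i => .inr (.inl i)))
      (Sum.elim (fun i => .inl (.inr i)) (fun i => .inr (.inr i)))
  let o : BrauerNode n → BrauerNode n ⊕ BrauerNode n :=
    Sum.elim (fun i => .inl (.inl i)) (fun i => .inr (.inr i))
  let κ : BrauerNode n ⊕ BrauerNode n → Component x y :=
    Sum.elim (fun v => Quot.mk _ (.inl (x.edge v))) (fun v => Quot.mk _ (.inr (y.edge v)))
  have hp : ∀ v, p (p v) = v := by
    rintro (v | v)
    · exact congrArg _ (x.partner_partner v)
    · exact congrArg _ (y.partner_partner v)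
  have hq : ∀ v, q (q v) = v := by rintro ((i | i) | (i | i)) <;> rfl
  have hpn : ∀ v, p v ≠ v := by
    rintro (v | v) h
    · exact x.partner_ne v (Sum.inl_injective h)
    · exact y.partner_ne v (Sum.inr_injective h)
  have hqo : ∀ v, q (o v) = o v := by rintro (i | i) <;> rfl
  have hoq : ∀ v, q v = v → ∃ u, v = o u := by
    rintro ((i | i) | (i | i)) h
    · exact ⟨.inl i, rfl⟩
    · cases h
    · cases h
    · exact ⟨.inr i, rfl⟩
  have ho : Function.Injective o := by
    rintro (i | i) (i' | i') h <;> cases h <;> rfl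
  have hκo : ∀ v, κ (o v) = outer x y v := by rintro (i | i) <;> rfl
  have hκp : ∀ v, κ (p v) = κ v := by
    rintro (v | v)
    · exact congrArg (fun e => Quot.mk _ (Sum.inl e)) (x.edge_partner v)
    · exact congrArg (fun e => Quot.mk _ (Sum.inr e)) (y.edge_partner v)
  have hκq : ∀ v, κ (q v) = κ v := by
    rintro ((i | i) | (i | i))
    · rfl
    · exact (Quot.sound (Joined.middle i)).symm
    · exact Quot.sound (Joined.middle i)
    · rfl
  obtain ⟨S, huS, hSp, hSq, hmin, w, hwS, hwu, hqw, huniq⟩ :=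
    exists_other_fixed p q hp hq hpn (o u) (hqo u)
  obtain ⟨w, rfl⟩ := hoq w hqw
  -- membership in `S` only depends on the component
  let sx : x.Edge → Prop := Quotient.lift (fun v => (Sum.inl v : BrauerNode n ⊕ BrauerNode n) ∈ S)
    (by rintro a b (rfl | rfl); exacts [rfl, propext (hSp (.inl b))])
  let sy : y.Edge → Prop := Quotient.lift (fun v => (Sum.inr v : BrauerNode n ⊕ BrauerNode n) ∈ S)
    (by rintro a b (rfl | rfl); exacts [rfl, propext (hSp (.inr b))])
  let s : Component x y → Prop := Quot.lift (Sum.elim sx sy)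
    (by rintro _ _ ⟨i⟩; exact propext (hSq (.inr (.inl i))))
  have hs : ∀ v, s (κ v) ↔ v ∈ S := by rintro (v | v) <;> rfl
  refine ⟨w, ⟨fun h => hwu (congrArg o h), ?_⟩, ?_⟩
  · have := hmin _ hwS {v | κ v = κ (o u)} rfl (fun v => by simp [hκp]) (fun v => by simp [hκq])
    rw [← hκo, ← hκo]
    exact this
  · rintro v ⟨hvu, hv⟩
    rw [← hκo, ← hκo] at hv
    have hvS : o v ∈ S := by rw [← hs, hv, hs]; exact huS
    rcases huniq _ hvS (hqo v) with h | h
    · exact absurd (ho h) hvu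
    · exact ho h

/-- Composition of `G`-Brauer diagrams: concatenate, forget the middle nodes and delete the loops.
Two outer nodes are joined in `x * y` when they lie in the same component of the concatenation, and
the label of the resulting edge is the product of the labels along that component. -/
noncomputable instance [CommMonoid G] : Mul (GBrauerDiagram G n) where
  mul x y :=
    { partner := fun u => (exists_unique_other_end x y u).choose
      label := fun u => componentLabel x y (outer x y u)
      partner_partner := fun u => by
        have h1 := (exists_unique_other_end x y u).choose_spec.1
        have h2 := (exists_unique_other_end x y
          (exists_unique_other_end x y u).choose).choose_spec.2 u
        exact (h2 ⟨h1.1.symm, h1.2.symm⟩).symm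
      partner_ne := fun u => (exists_unique_other_end x y u).choose_spec.1.1
      label_partner := fun u => by
        rw [(exists_unique_other_end x y u).choose_spec.1.2] }

theorem mul_label [CommMonoid G] (x y : GBrauerDiagram G n) (u : BrauerNode n) :
    (x * y).label u = componentLabel x y (outer x y u) := rfl

theorem outer_eq_iff [CommMonoid G] (x y : GBrauerDiagram G n) (u v : BrauerNode n) :
    outer x y u = outer x y v ↔ u = v ∨ u = (x * y).partner v := by
  have h := (exists_unique_other_end x y v).choose_spec
  constructor
  · intro huv
    by_cases h' : u = v
    · exact Or.inl h'
    · exact Or.inr (h.2 u ⟨h', huv⟩)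
  · rintro (rfl | rfl)
    · rfl
    · exact h.1.2

theorem eq_mul_of [CommMonoid G] (x y z : GBrauerDiagram G n)
    (h1 : ∀ u v, outer x y u = outer x y v ↔ u = v ∨ u = z.partner v)
    (h2 : ∀ u, componentLabel x y (outer x y u) = z.label u) : x * y = z := by
  apply GBrauerDiagram.ext
  · funext v
    have := (outer_eq_iff x y ((x * y).partner v) v).2 (Or.inr rfl)
    rw [h1] at this
    exact this.resolve_left ((x * y).partner_ne v)
  · funext u
    exact h2 u

/-- The identity diagram: the `i`-th left-hand node is joined to the `i`-th right-hand node, with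
all labels trivial. -/
instance [One G] : One (GBrauerDiagram G n) where
  one :=
    { partner := Sum.swap
      label := fun _ => 1
      partner_partner := Sum.swap_swap
      partner_ne := by rintro (i | i) h <;> cases h
      label_partner := fun _ => rfl }

/-- The loops of the concatenation of `x` and `y`: the components without outer nodes. -/
abbrev Loop (x y : GBrauerDiagram G n) : Type := {c : Component x y // c ∉ Set.range (outer x y)}

/-- The scalar produced by the loops of the concatenation of `x` and `y`: a loop whose edges have
labels with product `g` contributes the factor `g • δ`. -/
noncomputable def loopFactor [CommMonoid G] {k : Type*} [CommMonoid k] [SMul G k] (δ : k)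
    (x y : GBrauerDiagram G n) : k :=
  ∏ᶠ c : Loop x y, componentLabel x y c.1 • δ

end Composition

end GBrauerDiagram

namespace GBrauerDiagram

section Laws

variable {G : Type u} [CommMonoid G] {n : ℕ}

instance (x y : GBrauerDiagram G n) : Finite (Component x y) :=
  Finite.of_surjective _ Quot.mk_surjective

theorem one_partner (v : BrauerNode n) : (1 : GBrauerDiagram G n).partner v = v.swap := rfl

theorem one_edgeLabel (e : (1 : GBrauerDiagram G n).Edge) :
    (1 : GBrauerDiagram G n).edgeLabel e = 1 := by
  obtain ⟨v, rfl⟩ := edge_surjective _ e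
  rfl

theorem one_edge_inl (i : Fin n) :
    (1 : GBrauerDiagram G n).edge (.inl i) = (1 : GBrauerDiagram G n).edge (.inr i) :=
  (edge_eq_iff _ _ _).2 (Or.inr rfl)

/-- Concatenating with the identity on the right does not change the components. -/
theorem mul_one_aux (x : GBrauerDiagram G n) :
    Function.Bijective (fun e : x.Edge => (Quot.mk _ (.inl e) : Component x 1)) := by
  let ρ : Component x 1 → x.Edge := Quot.lift
    (Sum.elim id (Quotient.lift (fun v => x.edge (.inr (Sum.elim id id v)))
      (by rintro u v (rfl | rfl)
          · rfl
          · rcases v with v | v <;> rfl)))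
    (by rintro _ _ ⟨i⟩; rfl)
  refine ⟨Function.LeftInverse.injective (g := ρ) fun e => rfl, ?_⟩
  intro c
  obtain ⟨e | e, rfl⟩ := Quot.mk_surjective c
  · exact ⟨e, rfl⟩
  · obtain ⟨v, rfl⟩ := edge_surjective _ e
    rcases v with i | i
    · exact ⟨_, Quot.sound (Joined.middle i)⟩
    · rw [← one_edge_inl]
      exact ⟨_, Quot.sound (Joined.middle i)⟩

theorem outer_mul_one (x : GBrauerDiagram G n) (u : BrauerNode n) :
    outer x 1 u = Quot.mk _ (.inl (x.edge u)) := by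
  rcases u with i | i
  · rfl
  · refine Eq.symm ((Quot.sound (Joined.middle i)).trans ?_)
    rw [one_edge_inl]; rfl

/-- Concatenating with the identity on the left does not change the components. -/
theorem one_mul_aux (x : GBrauerDiagram G n) :
    Function.Bijective (fun e : x.Edge => (Quot.mk _ (.inr e) : Component 1 x)) := by
  let ρ : Component 1 x → x.Edge := Quot.lift
    (Sum.elim (Quotient.lift (fun v => x.edge (.inl (Sum.elim id id v)))
      (by rintro u v (rfl | rfl)
          · rfl
          · rcases v with v | v <;> rfl)) id)
    (by rintro _ _ ⟨i⟩; rfl)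
  refine ⟨Function.LeftInverse.injective (g := ρ) fun e => rfl, ?_⟩
  intro c
  obtain ⟨e | e, rfl⟩ := Quot.mk_surjective c
  · obtain ⟨v, rfl⟩ := edge_surjective _ e
    rcases v with i | i
    · rw [one_edge_inl]
      exact ⟨_, (Quot.sound (Joined.middle i)).symm⟩
    · exact ⟨_, (Quot.sound (Joined.middle i)).symm⟩
  · exact ⟨e, rfl⟩

theorem outer_one_mul (x : GBrauerDiagram G n) (u : BrauerNode n) :
    outer 1 x u = Quot.mk _ (.inr (x.edge u)) := by
  rcases u with i | i
  · refine Eq.trans ?_ (Quot.sound (Joined.middle i))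
    rw [← one_edge_inl]; rfl
  · rfl

protected theorem mul_one (x : GBrauerDiagram G n) : x * 1 = x := by
  apply eq_mul_of
  · intro u v
    rw [outer_mul_one, outer_mul_one, (mul_one_aux x).1.eq_iff, edge_eq_iff]
  · intro u
    rw [outer_mul_one, componentLabel, fibreProd_sum,
      fibreProd_one _ (fun e => Sum.elim x.edgeLabel (edgeLabel 1) (.inr e)) _ one_edgeLabel,
      mul_one, fibreProd_of_injective _ (mul_one_aux x).1]
    rfl

protected theorem one_mul (x : GBrauerDiagram G n) : 1 * x = x := by
  apply eq_mul_of
  · intro u v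
    rw [outer_one_mul, outer_one_mul, (one_mul_aux x).1.eq_iff, edge_eq_iff]
  · intro u
    rw [outer_one_mul, componentLabel, fibreProd_sum,
      fibreProd_one _ (fun e => Sum.elim (edgeLabel 1) x.edgeLabel (.inl e)) _ one_edgeLabel,
      one_mul, fibreProd_of_injective _ (one_mul_aux x).1]
    rfl

theorem loopFactor_of_surjective {k : Type*} [CommMonoid k] [SMul G k] (δ : k)
    (x y : GBrauerDiagram G n) (h : Function.Surjective (outer x y)) : loopFactor δ x y = 1 := by
  have : IsEmpty (Loop x y) := ⟨fun c => c.2 (h c.1)⟩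
  exact finprod_of_isEmpty _

theorem loopFactor_mul_one {k : Type*} [CommMonoid k] [SMul G k] (δ : k)
    (x : GBrauerDiagram G n) : loopFactor δ x 1 = 1 := by
  apply loopFactor_of_surjective
  intro c
  obtain ⟨e, rfl⟩ := (mul_one_aux x).2 c
  obtain ⟨v, rfl⟩ := edge_surjective _ e
  exact ⟨v, outer_mul_one x v⟩

theorem loopFactor_one_mul {k : Type*} [CommMonoid k] [SMul G k] (δ : k)
    (x : GBrauerDiagram G n) : loopFactor δ 1 x = 1 := by
  apply loopFactor_of_surjective
  intro c
  obtain ⟨e, rfl⟩ := (one_mul_aux x).2 c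
  obtain ⟨v, rfl⟩ := edge_surjective _ e
  exact ⟨v, outer_one_mul x v⟩

/-- The component of the concatenation of `x` and `y` that an edge of `x * y` comes from. -/
noncomputable def edgeComponent (x y : GBrauerDiagram G n) : (x * y).Edge → Component x y :=
  Quotient.lift (outer x y) (fun u v h => (outer_eq_iff x y u v).2 h)

theorem edgeComponent_edge (x y : GBrauerDiagram G n) (u : BrauerNode n) :
    edgeComponent x y ((x * y).edge u) = outer x y u := rfl

theorem edgeComponent_injective (x y : GBrauerDiagram G n) :
    Function.Injective (edgeComponent x y) := by
  intro e e' h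
  obtain ⟨u, rfl⟩ := edge_surjective _ e
  obtain ⟨v, rfl⟩ := edge_surjective _ e'
  rw [edgeComponent_edge, edgeComponent_edge] at h
  rw [edge_eq_iff, ← outer_eq_iff]
  exact h

theorem range_edgeComponent (x y : GBrauerDiagram G n) :
    Set.range (edgeComponent x y) = Set.range (outer x y) := by
  ext c
  constructor
  · rintro ⟨e, rfl⟩
    obtain ⟨u, rfl⟩ := edge_surjective _ e
    exact ⟨u, rfl⟩
  · rintro ⟨u, rfl⟩
    exact ⟨_, edgeComponent_edge x y u⟩

theorem edgeLabel_mul (x y : GBrauerDiagram G n) (e : (x * y).Edge) :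
    (x * y).edgeLabel e = componentLabel x y (edgeComponent x y e) := by
  obtain ⟨u, rfl⟩ := edge_surjective _ e
  rfl

/-- Gluing relation for the concatenation of three diagrams. -/
inductive Joined₃ (x y z : GBrauerDiagram G n) :
    (x.Edge ⊕ y.Edge) ⊕ z.Edge → (x.Edge ⊕ y.Edge) ⊕ z.Edge → Prop
  | left (i : Fin n) : Joined₃ x y z (.inl (.inl (x.edge (.inr i)))) (.inl (.inr (y.edge (.inl i))))
  | right (i : Fin n) : Joined₃ x y z (.inl (.inr (y.edge (.inr i)))) (.inr (z.edge (.inl i)))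

/-- Outer nodes in the concatenation of three diagrams. -/
def outer₃ (x y z : GBrauerDiagram G n) : BrauerNode n → (x.Edge ⊕ y.Edge) ⊕ z.Edge :=
  Sum.elim (fun i => .inl (.inl (x.edge (.inl i)))) (fun i => .inr (z.edge (.inr i)))

/-- Labels in the concatenation of three diagrams. -/
noncomputable def label₃ (x y z : GBrauerDiagram G n) : Quot (Joined₃ x y z) → G :=
  fibreProd (Quot.mk _) (Sum.elim (Sum.elim x.edgeLabel y.edgeLabel) z.edgeLabel)

theorem assoc_left {k : Type*} [CommMonoid k] (w : G → k) (x y z : GBrauerDiagram G n) :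
    (∀ u v, outer (x * y) z u = outer (x * y) z v ↔
      Quot.mk (Joined₃ x y z) (outer₃ x y z u) = Quot.mk _ (outer₃ x y z v)) ∧
    (∀ u, componentLabel (x * y) z (outer (x * y) z u) =
      label₃ x y z (Quot.mk _ (outer₃ x y z u))) ∧
    (∏ᶠ c : {c // c ∉ Set.range (fun u => Quot.mk (Joined₃ x y z) (outer₃ x y z u))},
      w (label₃ x y z c)) =
      (∏ᶠ c : Loop (x * y) z, w (componentLabel (x * y) z c.1)) *
        ∏ᶠ c : Loop x y, w (componentLabel x y c.1) := by
  let β : BrauerNode n → (x * y).Edge ⊕ z.Edge :=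
    Sum.elim (fun i => .inl ((x * y).edge (.inl i))) (fun i => .inr (z.edge (.inr i)))
  have hβo (u) : Quot.mk (Joined (x * y) z) (β u) = outer (x * y) z u := by
    rcases u with i | i <;> rfl
  have key := glue_two_stages (Joined x y) (edgeComponent x y) (edgeComponent_injective x y)
    (fun i : Fin n => (x * y).edge (.inr i)) (fun i => .inr (y.edge (.inr i))) (fun i => rfl)
    (fun i => z.edge (.inl i))
    (Quot.mk (Joined (x * y) z)) Quot.mk_surjective (fun i => Quot.sound (Joined.middle i))
    (fun f hf => ⟨Quot.lift f (by rintro _ _ ⟨i⟩; exact hf i), fun e => rfl⟩)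
    (Quot.mk (Joined₃ x y z)) Quot.mk_surjective
    (by rintro _ _ ⟨i⟩; exact Quot.sound (Joined₃.left i))
    (fun i => Quot.sound (Joined₃.right i))
    (fun f hf hf' => ⟨Quot.lift f (by
      rintro _ _ (i | i)
      · exact hf _ _ (Joined.middle i)
      · exact hf' i), fun e => rfl⟩)
    (Sum.elim x.edgeLabel y.edgeLabel) z.edgeLabel β (outer₃ x y z)
    (by
      rintro (i | i)
      · exact Or.inl ⟨_, _, rfl, rfl, rfl⟩
      · exact Or.inr ⟨_, rfl, rfl⟩) w
  have hℓ : (Sum.elim (fun d => fibreProd (Quot.mk (Joined x y))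
      (Sum.elim x.edgeLabel y.edgeLabel) (edgeComponent x y d)) z.edgeLabel) =
      Sum.elim (x * y).edgeLabel z.edgeLabel := by
    funext e
    rcases e with e | e
    · exact (edgeLabel_mul x y e).symm
    · rfl
  have hr : (fun u => Quot.mk (Joined (x * y) z) (β u)) = outer (x * y) z := funext hβo
  rw [hℓ, range_edgeComponent, hr] at key
  simp only [hβo] at key
  exact key

theorem assoc_right {k : Type*} [CommMonoid k] (w : G → k) (x y z : GBrauerDiagram G n) :
    (∀ u v, outer x (y * z) u = outer x (y * z) v ↔
      Quot.mk (Joined₃ x y z) (outer₃ x y z u) = Quot.mk _ (outer₃ x y z v)) ∧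
    (∀ u, componentLabel x (y * z) (outer x (y * z) u) =
      label₃ x y z (Quot.mk _ (outer₃ x y z u))) ∧
    (∏ᶠ c : {c // c ∉ Set.range (fun u => Quot.mk (Joined₃ x y z) (outer₃ x y z u))},
      w (label₃ x y z c)) =
      (∏ᶠ c : Loop x (y * z), w (componentLabel x (y * z) c.1)) *
        ∏ᶠ c : Loop y z, w (componentLabel y z c.1) := by
  let β : BrauerNode n → (y * z).Edge ⊕ x.Edge :=
    Sum.elim (fun i => .inr (x.edge (.inl i))) (fun i => .inl ((y * z).edge (.inr i)))
  let σ : (y.Edge ⊕ z.Edge) ⊕ x.Edge ≃ (x.Edge ⊕ y.Edge) ⊕ z.Edge :=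
    (Equiv.sumComm _ _).trans (Equiv.sumAssoc _ _ _).symm
  let m2 : (y * z).Edge ⊕ x.Edge → Component x (y * z) := fun e => Quot.mk _ e.swap
  let m3 : (y.Edge ⊕ z.Edge) ⊕ x.Edge → Quot (Joined₃ x y z) := fun e => Quot.mk _ (σ e)
  have hβo (u) : m2 (β u) = outer x (y * z) u := by
    rcases u with i | i <;> rfl
  have hβ3 (u) : m3 (σ.symm (outer₃ x y z u)) = Quot.mk _ (outer₃ x y z u) := by
    simp only [m3, Equiv.apply_symm_apply]
  have key := glue_two_stages (Joined y z) (edgeComponent y z) (edgeComponent_injective y z)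
    (fun i : Fin n => (y * z).edge (.inl i)) (fun i => .inl (y.edge (.inl i))) (fun i => rfl)
    (fun i => x.edge (.inr i))
    m2 (Quot.mk_surjective.comp (Equiv.sumComm _ _).surjective)
    (fun i => (Quot.sound (Joined.middle i)).symm)
    (fun f hf => ⟨Quot.lift (fun e => f e.swap) (by rintro _ _ ⟨i⟩; exact (hf i).symm), fun e => by
      rcases e with e | e <;> rfl⟩)
    m3 (Quot.mk_surjective.comp σ.surjective)
    (by rintro _ _ ⟨i⟩; exact Quot.sound (Joined₃.right i))
    (fun i => (Quot.sound (Joined₃.left i)).symm)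
    (fun f hf hf' => ⟨Quot.lift (fun e => f (σ.symm e)) (by
      rintro _ _ (i | i)
      · exact (hf' i).symm
      · exact hf _ _ (Joined.middle i)), fun e => by
        change f (σ.symm (σ e)) = f e
        rw [Equiv.symm_apply_apply]⟩)
    (Sum.elim y.edgeLabel z.edgeLabel) x.edgeLabel β (fun u => σ.symm (outer₃ x y z u))
    (by
      rintro (i | i)
      · exact Or.inr ⟨_, rfl, rfl⟩
      · exact Or.inl ⟨_, _, rfl, rfl, rfl⟩) w
  have hℓ : (Sum.elim (fun d => fibreProd (Quot.mk (Joined y z))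
      (Sum.elim y.edgeLabel z.edgeLabel) (edgeComponent y z d)) x.edgeLabel) =
      Sum.elim (y * z).edgeLabel x.edgeLabel := by
    funext e
    rcases e with e | e
    · exact (edgeLabel_mul y z e).symm
    · rfl
  have hl2 (c) : fibreProd m2 (Sum.elim (y * z).edgeLabel x.edgeLabel) c =
      componentLabel x (y * z) c :=
    fibreProd_congr (Equiv.sumComm _ _) _ _ (fun e => Iff.rfl)
      (by rintro (e | e) <;> rfl)
  have hl3 (c) : fibreProd m3 (Sum.elim (Sum.elim y.edgeLabel z.edgeLabel) x.edgeLabel) c =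
      label₃ x y z c :=
    fibreProd_congr σ _ _ (fun e => Iff.rfl) (by rintro ((e | e) | e) <;> rfl)
  have hr : (fun u => m2 (β u)) = outer x (y * z) := funext hβo
  have hr3 : (fun u => m3 (σ.symm (outer₃ x y z u))) =
      fun u => Quot.mk (Joined₃ x y z) (outer₃ x y z u) := funext hβ3
  rw [hℓ, range_edgeComponent, hr, hr3] at key
  simp only [hβo, hβ3, hl2, hl3] at key
  exact key

protected theorem mul_assoc (x y z : GBrauerDiagram G n) : x * y * z = x * (y * z) := by
  apply eq_mul_of
  · intro u v
    rw [(assoc_left (fun _ : G => (1 : ℕ)) x y z).1, ← (assoc_right (fun _ : G => (1 : ℕ)) x y z).1]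
    exact outer_eq_iff _ _ _ _
  · intro u
    rw [(assoc_left (fun _ : G => (1 : ℕ)) x y z).2.1,
      ← (assoc_right (fun _ : G => (1 : ℕ)) x y z).2.1]
    rfl

theorem loopFactor_assoc {k : Type*} [CommMonoid k] [SMul G k] (δ : k)
    (x y z : GBrauerDiagram G n) :
    loopFactor δ (x * y) z * loopFactor δ x y = loopFactor δ x (y * z) * loopFactor δ y z :=
  ((assoc_left (fun g : G => g • δ) x y z).2.2).symm.trans
    (assoc_right (fun g : G => g • δ) x y z).2.2

/-- Composition of diagrams is associative and unital. -/
noncomputable instance : Monoid (GBrauerDiagram G n) where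
  mul_assoc := GBrauerDiagram.mul_assoc
  one_mul := GBrauerDiagram.one_mul
  mul_one := GBrauerDiagram.mul_one

end Laws

end GBrauerDiagram

/-! ### The `G`-Brauer algebra -/

namespace GBrauerDiagram

section Through

variable {G : Type u} {n : ℕ}

/-- A diagram has no left-to-left and no right-to-right connections. -/
def IsThrough (x : GBrauerDiagram G n) : Prop :=
  (∀ i j, x.partner (.inl i) ≠ .inl j) ∧ ∀ i j, x.partner (.inr i) ≠ .inr j

theorem isThrough_of_left (x : GBrauerDiagram G n) (h : ∀ i j, x.partner (.inl i) ≠ .inl j) :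
    x.IsThrough := by
  refine ⟨h, ?_⟩
  have h' : ∀ i, ∃ j, x.partner (.inl i) = .inr j := fun i => by
    rcases hi : x.partner (.inl i) with j | j
    · exact absurd hi (h i j)
    · exact ⟨j, rfl⟩
  choose f hf using h'
  have hinj : Function.Injective f := fun i i' hii => by
    have := congrArg x.partner ((hf i).trans ((congrArg Sum.inr hii).trans (hf i').symm))
    rw [x.partner_partner, x.partner_partner] at this
    exact Sum.inl_injective this
  have hsurj := Finite.surjective_of_injective hinj
  intro i j hij
  obtain ⟨i', rfl⟩ := hsurj i
  rw [← hf, x.partner_partner] at hij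
  cases hij

theorem isThrough_of_right (x : GBrauerDiagram G n) (h : ∀ i j, x.partner (.inr i) ≠ .inr j) :
    x.IsThrough := by
  refine ⟨?_, h⟩
  have h' : ∀ i, ∃ j, x.partner (.inr i) = .inl j := fun i => by
    rcases hi : x.partner (.inr i) with j | j
    · exact ⟨j, rfl⟩
    · exact absurd hi (h i j)
  choose f hf using h'
  have hinj : Function.Injective f := fun i i' hii => by
    have := congrArg x.partner ((hf i).trans ((congrArg Sum.inl hii).trans (hf i').symm))
    rw [x.partner_partner, x.partner_partner] at this
    exact Sum.inr_injective this
  have hsurj := Finite.surjective_of_injective hinj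
  intro i j hij
  obtain ⟨i', rfl⟩ := hsurj i
  rw [← hf, x.partner_partner] at hij
  cases hij

theorem partner_mul_of_outer_eq [CommMonoid G] (x y : GBrauerDiagram G n) (u v : BrauerNode n)
    (h : outer x y u = outer x y v) (huv : u ≠ v) : (x * y).partner v = u :=
  (((outer_eq_iff x y u v).1 h).resolve_left huv).symm

theorem isThrough_mul_iff [CommMonoid G] (x y : GBrauerDiagram G n) :
    (x * y).IsThrough ↔ x.IsThrough ∧ y.IsThrough := by
  constructor
  · intro h
    constructor
    · refine x.isThrough_of_left fun i j hij => h.1 i j ?_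
      refine partner_mul_of_outer_eq x y _ _ ?_ (hij ▸ x.partner_ne _)
      change Quot.mk _ (Sum.inl (x.edge (.inl j))) = Quot.mk _ (Sum.inl (x.edge (.inl i)))
      rw [← hij, edge_partner]
    · refine y.isThrough_of_right fun i j hij => h.2 i j ?_
      refine partner_mul_of_outer_eq x y _ _ ?_ (hij ▸ y.partner_ne _)
      change Quot.mk _ (Sum.inr (y.edge (.inr j))) = Quot.mk _ (Sum.inr (y.edge (.inr i)))
      rw [← hij, edge_partner]
  · rintro ⟨hx, hy⟩
    refine (x * y).isThrough_of_left fun i j hij => ?_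
    obtain ⟨a, ha⟩ : ∃ a, x.partner (.inl i) = .inr a := by
      rcases h : x.partner (.inl i) with a | a
      · exact absurd h (hx.1 i a)
      · exact ⟨a, rfl⟩
    obtain ⟨b, hb⟩ : ∃ b, y.partner (.inl a) = .inr b := by
      rcases h : y.partner (.inl a) with b | b
      · exact absurd h (hy.1 a b)
      · exact ⟨b, rfl⟩
    have h : outer x y (.inr b) = outer x y (.inl i) := by
      change Quot.mk _ (Sum.inr (y.edge (.inr b))) = Quot.mk _ (Sum.inl (x.edge (.inl i)))
      rw [← hb, edge_partner, ← x.edge_partner (.inl i), ha]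
      exact (Quot.sound (Joined.middle a)).symm
    rw [partner_mul_of_outer_eq x y _ _ h (by simp)] at hij
    cases hij

theorem one_isThrough [One G] : (1 : GBrauerDiagram G n).IsThrough :=
  by
  constructor <;> intro i j h <;> cases h

theorem loopFactor_of_isThrough [CommMonoid G] {k : Type*} [CommMonoid k] [SMul G k] (δ : k)
    (x y : GBrauerDiagram G n) (hx : x.IsThrough) (hy : y.IsThrough) : loopFactor δ x y = 1 := by
  apply loopFactor_of_surjective
  intro c
  obtain ⟨e | e, rfl⟩ := Quot.mk_surjective c
  · obtain ⟨u, rfl⟩ := edge_surjective _ e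
    rcases u with i | i
    · exact ⟨.inl i, rfl⟩
    · rcases h : x.partner (.inr i) with j | j
      · refine ⟨.inl j, ?_⟩
        change Quot.mk _ (Sum.inl (x.edge (.inl j))) = _
        rw [← h, edge_partner]
      · exact absurd h (hx.2 i j)
  · obtain ⟨u, rfl⟩ := edge_surjective _ e
    rcases u with i | i
    · rcases h : y.partner (.inl i) with j | j
      · exact absurd h (hy.1 i j)
      · refine ⟨.inr j, ?_⟩
        change Quot.mk _ (Sum.inr (y.edge (.inr j))) = _
        rw [← h, edge_partner]
    · exact ⟨.inr i, rfl⟩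

end Through

end GBrauerDiagram

/-- The `G`-Brauer algebra with parameter `δ`: formal `k`-linear combinations of `G`-Brauer
`n`-diagrams, with the bilinear extension of composition of diagrams in which each loop with label
`g` is replaced by the factor `g • δ`. -/
def GBrauerAlgebra (G : Type u) (n : ℕ) (k : Type u) [CommRing k] (_δ : k) : Type u :=
  GBrauerDiagram G n →₀ k

namespace GBrauerAlgebra

variable {G : Type u} {n : ℕ} {k : Type u} [CommRing k] {δ : k}

noncomputable instance : AddCommGroup (GBrauerAlgebra G n k δ) :=
  inferInstanceAs (AddCommGroup (GBrauerDiagram G n →₀ k))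

noncomputable instance : Module k (GBrauerAlgebra G n k δ) :=
  inferInstanceAs (Module k (GBrauerDiagram G n →₀ k))

/-- The multiple `a • x` of a diagram `x`, as an element of the `G`-Brauer algebra. -/
noncomputable def single (x : GBrauerDiagram G n) (a : k) : GBrauerAlgebra G n k δ :=
  Finsupp.single x a

theorem single_zero (x : GBrauerDiagram G n) : (single x 0 : GBrauerAlgebra G n k δ) = 0 :=
  Finsupp.single_zero x

theorem single_add (x : GBrauerDiagram G n) (a b : k) :
    (single x (a + b) : GBrauerAlgebra G n k δ) = single x a + single x b :=
  Finsupp.single_add x a b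

theorem smul_single (x : GBrauerDiagram G n) (a b : k) :
    (a • single x b : GBrauerAlgebra G n k δ) = single x (a * b) :=
  Finsupp.smul_single a x b

theorem induction {p : GBrauerAlgebra G n k δ → Prop} (f : GBrauerAlgebra G n k δ) (h0 : p 0)
    (hadd : ∀ f g, p f → p g → p (f + g)) (hs : ∀ x a, p (single x a)) : p f :=
  Finsupp.induction_linear f h0 hadd hs

open Classical in
/-- The `k`-linear map sending the diagrams without left-to-left and right-to-right connections to
`1` and all other diagrams to `0`. -/
noncomputable def augmentationLinear (G : Type u) (n : ℕ) {k : Type u} [CommRing k] (δ : k) :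
    GBrauerAlgebra G n k δ →ₗ[k] k :=
  Finsupp.linearCombination k fun x : GBrauerDiagram G n => if x.IsThrough then (1 : k) else 0

open Classical in
theorem augmentationLinear_single (x : GBrauerDiagram G n) (a : k) :
    augmentationLinear G n δ (single x a) = if x.IsThrough then a else 0 := by
  refine (Finsupp.linearCombination_single k a x).trans ?_
  simp

variable [CommMonoid G]

noncomputable instance : One (GBrauerAlgebra G n k δ) where
  one := single 1 1

theorem one_def : (1 : GBrauerAlgebra G n k δ) = single 1 1 := rfl

variable [MulSemiringAction G k]

/-- Left multiplication by a diagram `x`: the linear extension of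
`y ↦ (loop factor of x and y) • (x * y)`. -/
noncomputable def diagramMul (δ : k) (x : GBrauerDiagram G n) :
    GBrauerAlgebra G n k δ →ₗ[k] GBrauerAlgebra G n k δ :=
  Finsupp.linearCombination k fun y : GBrauerDiagram G n =>
    single (x * y) (GBrauerDiagram.loopFactor δ x y)

/-- The bilinear extension of `(x, y) ↦ (loop factor of x and y) • (x * y)` on diagrams. -/
noncomputable def mulBilin (G : Type u) (n : ℕ) {k : Type u} [CommRing k] (δ : k) [CommMonoid G]
    [MulSemiringAction G k] :
    GBrauerAlgebra G n k δ →ₗ[k] GBrauerAlgebra G n k δ →ₗ[k] GBrauerAlgebra G n k δ :=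
  Finsupp.linearCombination k fun x : GBrauerDiagram G n => diagramMul δ x

noncomputable instance : Mul (GBrauerAlgebra G n k δ) where
  mul f g := mulBilin G n δ f g

theorem mul_def (f g : GBrauerAlgebra G n k δ) : f * g = mulBilin G n δ f g := rfl

theorem single_mul_single (x y : GBrauerDiagram G n) (a b : k) :
    (single x a * single y b : GBrauerAlgebra G n k δ) =
      single (x * y) (a * b * GBrauerDiagram.loopFactor δ x y) := by
  have h1 : mulBilin G n δ (single x a) = a • diagramMul δ x :=
    Finsupp.linearCombination_single k a x
  have h2 : diagramMul δ x (single y b) = b • single (x * y) (GBrauerDiagram.loopFactor δ x y) :=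
    Finsupp.linearCombination_single k b y
  rw [mul_def, h1, LinearMap.smul_apply, h2, smul_single, smul_single, mul_assoc]

protected theorem zero_mul (f : GBrauerAlgebra G n k δ) : 0 * f = 0 := by
  rw [mul_def, map_zero, LinearMap.zero_apply]

protected theorem mul_zero (f : GBrauerAlgebra G n k δ) : f * 0 = 0 := by
  rw [mul_def, map_zero]

protected theorem add_mul (f g h : GBrauerAlgebra G n k δ) : (f + g) * h = f * h + g * h := by
  rw [mul_def, map_add, LinearMap.add_apply]; rfl

protected theorem mul_add (f g h : GBrauerAlgebra G n k δ) : f * (g + h) = f * g + f * h := by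
  rw [mul_def, map_add]; rfl

protected theorem mul_assoc (f g h : GBrauerAlgebra G n k δ) : f * g * h = f * (g * h) := by
  induction f using induction with
  | h0 => simp only [GBrauerAlgebra.zero_mul]
  | hadd f f' hf hf' => simp only [GBrauerAlgebra.add_mul, hf, hf']
  | hs x a =>
    induction g using induction with
    | h0 => simp only [GBrauerAlgebra.zero_mul, GBrauerAlgebra.mul_zero]
    | hadd g g' hg hg' => simp only [GBrauerAlgebra.add_mul, GBrauerAlgebra.mul_add, hg, hg']
    | hs y b =>
      induction h using induction with
      | h0 => simp only [GBrauerAlgebra.mul_zero]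
      | hadd h h' hh hh' => simp only [GBrauerAlgebra.mul_add, hh, hh']
      | hs z c =>
        simp only [single_mul_single]
        rw [mul_assoc x y z]
        congr 1
        have := GBrauerDiagram.loopFactor_assoc δ x y z
        linear_combination (a * b * c) * this

protected theorem one_mul (f : GBrauerAlgebra G n k δ) : 1 * f = f := by
  induction f using induction with
  | h0 => exact GBrauerAlgebra.mul_zero _
  | hadd f g hf hg => rw [GBrauerAlgebra.mul_add, hf, hg]
  | hs x a => rw [one_def, single_mul_single, GBrauerDiagram.loopFactor_one_mul, one_mul, one_mul,
      mul_one]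

protected theorem mul_one (f : GBrauerAlgebra G n k δ) : f * 1 = f := by
  induction f using induction with
  | h0 => exact GBrauerAlgebra.zero_mul _
  | hadd f g hf hg => rw [GBrauerAlgebra.add_mul, hf, hg]
  | hs x a => rw [one_def, single_mul_single, GBrauerDiagram.loopFactor_mul_one, mul_one, mul_one,
      mul_one]

noncomputable instance : Ring (GBrauerAlgebra G n k δ) :=
  { (inferInstance : AddCommGroup (GBrauerAlgebra G n k δ)) with
    mul := (· * ·)
    one := 1
    zero_mul := GBrauerAlgebra.zero_mul
    mul_zero := GBrauerAlgebra.mul_zero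
    left_distrib := GBrauerAlgebra.mul_add
    right_distrib := GBrauerAlgebra.add_mul
    mul_assoc := GBrauerAlgebra.mul_assoc
    one_mul := GBrauerAlgebra.one_mul
    mul_one := GBrauerAlgebra.mul_one }

protected theorem smul_mul (c : k) (f g : GBrauerAlgebra G n k δ) : c • f * g = c • (f * g) := by
  rw [mul_def, map_smul, LinearMap.smul_apply]; rfl

protected theorem mul_smul (c : k) (f g : GBrauerAlgebra G n k δ) : f * c • g = c • (f * g) := by
  rw [mul_def, map_smul]; rfl

noncomputable instance : Algebra k (GBrauerAlgebra G n k δ) :=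
  Algebra.ofModule GBrauerAlgebra.smul_mul GBrauerAlgebra.mul_smul

/-- The action of the `G`-Brauer algebra on the trivial module, as an algebra map to `k`. -/
noncomputable def augmentation (G : Type u) [CommMonoid G] (n : ℕ) {k : Type u} [CommRing k]
    [MulSemiringAction G k] (δ : k) : GBrauerAlgebra G n k δ →ₐ[k] k :=
  AlgHom.ofLinearMap (augmentationLinear G n δ)
    (by rw [one_def, augmentationLinear_single, if_pos GBrauerDiagram.one_isThrough])
    (by
      intro f g
      induction f using induction with
      | h0 => rw [zero_mul, map_zero, zero_mul]
      | hadd f f' hf hf' => rw [add_mul, map_add, map_add, add_mul, hf, hf']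
      | hs x a =>
        induction g using induction with
        | h0 => rw [mul_zero, map_zero, mul_zero]
        | hadd g g' hg hg' => rw [mul_add, map_add, map_add, mul_add, hg, hg']
        | hs y b =>
          rw [single_mul_single, augmentationLinear_single, augmentationLinear_single,
            augmentationLinear_single]
          by_cases hx : x.IsThrough
          · by_cases hy : y.IsThrough
            · rw [if_pos ((GBrauerDiagram.isThrough_mul_iff x y).2 ⟨hx, hy⟩), if_pos hx, if_pos hy,
                GBrauerDiagram.loopFactor_of_isThrough δ x y hx hy, mul_one]
            · rw [if_neg fun h => hy ((GBrauerDiagram.isThrough_mul_iff x y).1 h).2, if_neg hy,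
                mul_zero]
          · rw [if_neg fun h => hx ((GBrauerDiagram.isThrough_mul_iff x y).1 h).1, if_neg hx,
              zero_mul])

end GBrauerAlgebra

/-! ### `Tor` over a noncommutative algebra, and trivial modules -/

open CategoryTheory TensorProduct

section BalancedTensor

variable (k : Type u) [CommRing k] (A : Type u) [Ring A] [Algebra k A]
  (M : Type u) [AddCommGroup M] [Module k M] [Module Aᵐᵒᵖ M]

/-- The relations `(m · a) ⊗ n = m ⊗ (a · n)` that cut `M ⊗_A N` out of `M ⊗_k N`, for a right
`A`-module `M` (a module over the opposite ring) and a left `A`-module `N`. -/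
def balancedRelations (N : Type u) [AddCommGroup N] [Module k N] [Module A N] :
    Submodule k (M ⊗[k] N) :=
  Submodule.span k {t | ∃ (m : M) (a : A) (x : N),
    t = (MulOpposite.op a • m) ⊗ₜ[k] x - m ⊗ₜ[k] (a • x)}

/-- The tensor product `M ⊗_A N` of a right and a left module over a `k`-algebra `A`. -/
abbrev BalancedTensor (N : Type u) [AddCommGroup N] [Module k N] [Module A N] : Type u :=
  (M ⊗[k] N) ⧸ balancedRelations k A M N

/-- The map `M ⊗_A N → M ⊗_A N'` induced by a map `N → N'`. -/
noncomputable def BalancedTensor.map {N N' : Type u}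
    [AddCommGroup N] [Module k N] [Module A N] [IsScalarTower k A N]
    [AddCommGroup N'] [Module k N'] [Module A N'] [IsScalarTower k A N'] (f : N →ₗ[A] N') :
    BalancedTensor k A M N →ₗ[k] BalancedTensor k A M N' :=
  Submodule.mapQ _ _ (LinearMap.lTensor M (f.restrictScalars k)) (by
    rw [balancedRelations, Submodule.span_le]
    rintro _ ⟨m, a, x, rfl⟩
    refine Submodule.subset_span ⟨m, a, f x, ?_⟩
    simp)

/-- The functor `M ⊗_A -` from left `A`-modules to `k`-modules. -/
noncomputable def balancedTensorFunctor : ModuleCat.{u} A ⥤ ModuleCat.{u} k where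
  obj N :=
    letI := Module.restrictScalars k A N
    ModuleCat.of k (BalancedTensor k A M N)
  map {N N'} f :=
    letI := Module.restrictScalars k A N
    letI := Module.restrictScalars k A N'
    haveI := IsScalarTower.restrictScalars k A N
    haveI := IsScalarTower.restrictScalars k A N'
    ModuleCat.ofHom (BalancedTensor.map k A M f.hom)
  map_id N := by
    let _ := Module.restrictScalars k A N
    have := IsScalarTower.restrictScalars k A N
    apply ModuleCat.hom_ext
    refine Submodule.linearMap_qext _ (TensorProduct.ext' fun m x => ?_)
    rfl
  map_comp {N N' N''} f g := by
    let _ := Module.restrictScalars k A N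
    let _ := Module.restrictScalars k A N'
    let _ := Module.restrictScalars k A N''
    apply ModuleCat.hom_ext
    refine Submodule.linearMap_qext _ (TensorProduct.ext' fun m x => ?_)
    rfl

instance : (balancedTensorFunctor k A M).Additive where
  map_add {N N'} f g := by
    let _ := Module.restrictScalars k A N
    let _ := Module.restrictScalars k A N'
    have := IsScalarTower.restrictScalars k A N
    have := IsScalarTower.restrictScalars k A N'
    apply ModuleCat.hom_ext
    refine Submodule.linearMap_qext _ (TensorProduct.ext' fun m x => ?_)
    change Submodule.Quotient.mk (m ⊗ₜ[k] (f.hom x + g.hom x)) = _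
    rw [TensorProduct.tmul_add]
    rfl

/-- `Tor_i^A(M, N)` as a `k`-module: the `i`-th left derived functor of `M ⊗_A -` applied to `N`. -/
noncomputable def torModule [IsScalarTower k Aᵐᵒᵖ M] (N : Type u) [AddCommGroup N] [Module A N] (i : ℕ) : ModuleCat.{u} k :=
  ((balancedTensorFunctor k A M).leftDerived i).obj (ModuleCat.of A N)

end BalancedTensor

section Trivial

/-- A single copy of the ground ring `k`, on which a `k`-algebra `A` acts from the left and from
the right through an algebra map `ε : A → k`. -/
def TrivialModule {k : Type u} [CommRing k] {A : Type u} [Ring A] [Algebra k A]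
    (_ε : A →ₐ[k] k) : Type u := k

variable {k : Type u} [CommRing k] {A : Type u} [Ring A] [Algebra k A] (ε : A →ₐ[k] k)

instance : AddCommGroup (TrivialModule ε) := inferInstanceAs (AddCommGroup k)

instance : Module k (TrivialModule ε) := inferInstanceAs (Module k k)

instance : Module A (TrivialModule ε) := Module.compHom k (ε : A →+* k)

instance : Module Aᵐᵒᵖ (TrivialModule ε) :=
  Module.compHom k ((ε : A →+* k).fromOpposite fun a b => mul_comm (ε a) (ε b))

instance : IsScalarTower k A (TrivialModule ε) :=
  ⟨fun c a m =>
    (fun m' => by rw [map_smul, smul_eq_mul, mul_assoc] :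
      ∀ m' : k, ε (c • a) * m' = c * (ε a * m')) m⟩

instance : IsScalarTower k Aᵐᵒᵖ (TrivialModule ε) :=
  ⟨fun c a m =>
    (fun m' => by rw [map_smul, smul_eq_mul, mul_assoc] :
      ∀ m' : k, ε (c • a.unop) * m' = c * (ε a.unop * m')) m⟩

/-- `Tor_i^A(𝟙, 𝟙)` for the trivial right and left modules given by `ε : A → k`. -/
noncomputable def torTrivial (i : ℕ) : ModuleCat.{u} k :=
  torModule k A (TrivialModule ε) (TrivialModule ε) i

/-- The augmentation of a group algebra: every group element acts as `1`. -/
noncomputable def groupAlgebraAugmentation (k : Type u) [CommRing k] (H : Type u) [Group H] :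
    MonoidAlgebra k H →ₐ[k] k :=
  MonoidAlgebra.lift k k H 1

end Trivial

/-- The semidirect product `G^n ⋊ Σ_n`, where `σ ∈ Σ_n` acts on `G^n` by permuting the factors:
`(σ · f) i = f (σ⁻¹ i)`. -/
abbrev PermWreath (G : Type u) [Group G] (n : ℕ) : Type u :=
  (Fin n → G) ⋊[(mulAutArrow : Equiv.Perm (Fin n) →* MulAut (Fin n → G))] Equiv.Perm (Fin n)

/-!
Write `A` for the `G`-Brauer algebra, `I` for the ideal spanned by the diagrams with a left-to-left
or right-to-right connection, and `B = k[G^n ⋊ Σ_n]`. The remaining diagrams are those of the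
elements of `G^n ⋊ Σ_n`, so that `A → A / I = B` is a split surjection of algebras through which `A`
acts on `𝟙`.

Let `P` be a projective resolution of `𝟙` over `A`. Base change gives a complex `P / I P` of
projective `B`-modules with `𝟙 ⊗_B (P / I P) = 𝟙 ⊗_A P`. If the subcomplex `I P` is exact in all
degrees, then `P / I P` is a projective resolution of `𝟙` over `B`, and both `Tor`s are the homology
of the same complex (`torTrivial_iso_of_isAcyclicOn`).

Exactness of `I P` uses that `δ` is a unit. A set `D` of left-hand nodes that is a union of labelled
left-to-left arcs of a diagram `x` determines the right ideal `J` spanned by all diagrams that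
contain these arcs. A suitable multiple `e` of the diagram `cupCap x D`, which has the given arcs on
the left, their mirror images on the right and horizontal edges elsewhere, is an idempotent of `I`
with `J = e A`: the closed loops in `e y` only produce a unit factor, by which one can divide. Hence
`J P = e P` is a direct summand of the complex `P`, and it is exact since `e` annihilates `𝟙`
(`isAcyclicOn_of_idempotent`). The intersection of two such ideals is zero or of the same form, and
`I` is the sum of all of them. As the ideals are spanned by sets of diagrams, finite sums of them
distribute over intersections, and a Mayer–Vietoris induction (`isAcyclicOn_foldr_union`) shows that
`J P` is exact for each finite sum `J`. Every element of `I P` lies in such a `J P`.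

Over a group algebra, `𝟙 ⊗_{k[H]} V` is the module of coinvariants of `V`, which identifies `Tor`
with group homology by means of the bar resolution.
-/

/-! ### The universal property of `𝟙 ⊗_A N` -/

section TrivialTensor

variable {k : Type u} [CommRing k] {A : Type u} [Ring A] [Algebra k A] (ε : A →ₐ[k] k)

/-- The functor `𝟙 ⊗_A -` for the trivial right module given by `ε : A → k`. -/
noncomputable abbrev trivialTensor : ModuleCat.{u} A ⥤ ModuleCat.{u} k :=
  balancedTensorFunctor k A (TrivialModule ε)

theorem TrivialModule.smul_eq_zero {a : A} (ha : ε a = 0) (m : TrivialModule ε) : a • m = 0 := by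
  change (ε a * (show k from m) : k) = 0
  rw [ha, zero_mul]

namespace trivialTensor

/-- The universal map `N → 𝟙 ⊗_A N`, `x ↦ 1 ⊗ x`. -/
noncomputable def mk (N : ModuleCat.{u} A) : N →+ (trivialTensor ε).obj N :=
  letI := Module.restrictScalars k A N
  { toFun := fun x => Submodule.Quotient.mk ((show TrivialModule ε from (1 : k)) ⊗ₜ[k] x)
    map_zero' := by rw [TensorProduct.tmul_zero]; rfl
    map_add' := fun x y => by rw [TensorProduct.tmul_add]; rfl }

theorem mk_smul (N : ModuleCat.{u} A) (a : A) (x : N) : mk ε N (a • x) = ε a • mk ε N x := by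
  let _ := Module.restrictScalars k A N
  refine Eq.symm ((Submodule.Quotient.eq (balancedRelations k A (TrivialModule ε) N)).2 ?_)
  exact Submodule.subset_span ⟨(show TrivialModule ε from (1 : k)), a, x, rfl⟩

theorem mk_naturality {N N' : ModuleCat.{u} A} (f : N ⟶ N') (x : N) :
    (trivialTensor ε).map f (mk ε N x) = mk ε N' (f x) := rfl

/-- The additive maps `N → V` that intertwine the action of `A` with scalar multiplication
through `ε` factor through `𝟙 ⊗_A N`. -/
noncomputable def lift {N : ModuleCat.{u} A} {V : ModuleCat.{u} k} (f : N →+ V)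
    (hf : ∀ (a : A) (x : N), f (a • x) = ε a • f x) : (trivialTensor ε).obj N ⟶ V :=
  letI := Module.restrictScalars k A N
  let fk : N →ₗ[k] V :=
    { f with
      map_smul' := fun c x => by
        have := hf (algebraMap k A c) x
        rw [AlgHom.commutes] at this
        exact this }
  ModuleCat.ofHom (Submodule.liftQ _
    (TensorProduct.lift (LinearMap.lsmul k (N →ₗ[k] V) |>.flip fk :
      TrivialModule ε →ₗ[k] N →ₗ[k] V)) (by
      rw [balancedRelations, Submodule.span_le]
      rintro _ ⟨m, a, x, rfl⟩
      have h : (ε a * (show k from m)) • f x = (show k from m) • f (a • x) := by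
        rw [hf, smul_smul, mul_comm]
      simp only [SetLike.mem_coe, LinearMap.mem_ker, map_sub]
      exact sub_eq_zero.2 h))

@[simp]
theorem lift_mk {N : ModuleCat.{u} A} {V : ModuleCat.{u} k} (f : N →+ V)
    (hf : ∀ (a : A) (x : N), f (a • x) = ε a • f x) (x : N) : lift ε f hf (mk ε N x) = f x :=
  one_smul k (f x)

theorem hom_ext {N : ModuleCat.{u} A} {V : ModuleCat.{u} k} {f g : (trivialTensor ε).obj N ⟶ V}
    (h : ∀ x, f (mk ε N x) = g (mk ε N x)) : f = g := by
  let _ := Module.restrictScalars k A N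
  apply ModuleCat.hom_ext
  refine Submodule.linearMap_qext _ (TensorProduct.ext' fun m x => ?_)
  have key : (Submodule.Quotient.mk (m ⊗ₜ[k] x) : BalancedTensor k A (TrivialModule ε) N) =
      (show k from m) • mk ε N x := by
    have : m = (show k from m) • (show TrivialModule ε from (1 : k)) := (mul_one (show k from m)).symm
    conv_lhs => rw [this, ← TensorProduct.smul_tmul']
    rfl
  change f.hom (Submodule.Quotient.mk _) = g.hom (Submodule.Quotient.mk _)
  rw [key, map_smul, map_smul]
  exact congrArg _ (h x)

end trivialTensor

end TrivialTensor

/-! ### Base change along a split quotient of algebras -/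

section IdealMul

variable {A : Type u} [Ring A]

/-- The additive subgroup `J · N` of an `A`-module `N` generated by the products `j • x` with
`j ∈ J`, for an additive subgroup `J` of `A`. -/
def idealMul (J : AddSubgroup A) (N : Type u) [AddCommGroup N] [Module A N] : AddSubgroup N :=
  AddSubgroup.closure {z | ∃ j ∈ J, ∃ x : N, j • x = z}

variable {N N' : Type u} [AddCommGroup N] [Module A N] [AddCommGroup N'] [Module A N']

theorem smul_mem_idealMul {J : AddSubgroup A} {j : A} (hj : j ∈ J) (x : N) :
    j • x ∈ idealMul J N :=
  AddSubgroup.subset_closure ⟨j, hj, x, rfl⟩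

theorem idealMul_le {J : AddSubgroup A} {S : AddSubgroup N} (h : ∀ j ∈ J, ∀ x : N, j • x ∈ S) :
    idealMul J N ≤ S := by
  rw [idealMul, AddSubgroup.closure_le]
  rintro _ ⟨j, hj, x, rfl⟩
  exact h j hj x

theorem idealMul_mono {J J' : AddSubgroup A} (h : J ≤ J') : idealMul J N ≤ idealMul J' N :=
  idealMul_le fun _ hj x => smul_mem_idealMul (h hj) x

theorem map_mem_idealMul {J : AddSubgroup A} (f : N →ₗ[A] N') {z : N} (hz : z ∈ idealMul J N) :
    f z ∈ idealMul J N' := by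
  have : idealMul J N ≤ (idealMul J N').comap f.toAddMonoidHom :=
    idealMul_le fun j hj x => by
      change f (j • x) ∈ idealMul J N'
      rw [map_smul]
      exact smul_mem_idealMul hj _
  exact this hz

/-- The `A`-submodule `I · N` for the kernel `I` of a ring homomorphism out of `A`. -/
def kerMul {B : Type u} [Ring B] (π : A →+* B) (N : Type u) [AddCommGroup N] [Module A N] :
    Submodule A N :=
  { idealMul (RingHom.ker π).toAddSubgroup N with
    smul_mem' := fun a z hz => by
      have : idealMul (RingHom.ker π).toAddSubgroup N ≤
          (idealMul (RingHom.ker π).toAddSubgroup N).comap (DistribSMul.toAddMonoidHom N a) :=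
        idealMul_le fun j hj x => by
          change a • j • x ∈ idealMul (RingHom.ker π).toAddSubgroup N
          rw [smul_smul]
          exact smul_mem_idealMul (Ideal.mul_mem_left _ _ hj) _
      exact this hz }

end IdealMul

section BaseChange

variable {k : Type u} [CommRing k] {A B : Type u} [Ring A] [Algebra k A] [Ring B] [Algebra k B]
  (π : A →ₐ[k] B) (s : B →ₐ[k] A)

/-- The functor `N ↦ N / I N` from `A`-modules to `A`-modules, for `I = ker π`. -/
noncomputable def quotKer : ModuleCat.{u} A ⥤ ModuleCat.{u} A where
  obj N := ModuleCat.of A (N ⧸ kerMul π.toRingHom N)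
  map f := ModuleCat.ofHom (Submodule.mapQ _ _ f.hom fun _ hz => map_mem_idealMul f.hom hz)
  map_id N := by
    apply ModuleCat.hom_ext
    exact Submodule.linearMap_qext _ rfl
  map_comp f g := by
    apply ModuleCat.hom_ext
    exact Submodule.linearMap_qext _ rfl

instance : (quotKer π).Additive where
  map_add {N N'} f g := by
    apply ModuleCat.hom_ext
    exact Submodule.linearMap_qext _ rfl

/-- Base change `N ↦ N / I N` from `A`-modules to `B`-modules along a surjection `π : A → B` with
kernel `I`. The section `s` of `π` provides the action of `B`. -/
noncomputable abbrev splitBaseChange : ModuleCat.{u} A ⥤ ModuleCat.{u} B :=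
  quotKer π ⋙ ModuleCat.restrictScalars s.toRingHom

namespace splitBaseChange

/-- The quotient map `N → N / I N`. -/
noncomputable def mk (N : ModuleCat.{u} A) : N →+ (splitBaseChange π s).obj N :=
  (kerMul π.toRingHom N).mkQ.toAddMonoidHom

theorem mk_surjective (N : ModuleCat.{u} A) : Function.Surjective (mk π s N) :=
  Submodule.mkQ_surjective _

theorem mk_eq_zero {N : ModuleCat.{u} A} {x : N} :
    mk π s N x = 0 ↔ x ∈ idealMul (RingHom.ker π.toRingHom).toAddSubgroup N :=
  Submodule.Quotient.mk_eq_zero _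

theorem map_mk {N N' : ModuleCat.{u} A} (f : N ⟶ N') (x : N) :
    (splitBaseChange π s).map f (mk π s N x) = mk π s N' (f x) := rfl

theorem smul_mk (N : ModuleCat.{u} A) (b : B) (x : N) :
    b • mk π s N x = mk π s N (s b • x) := rfl

/-- An additive map that vanishes on the products `a • x` with `a ∈ I` factors through `N / I N`. -/
noncomputable def descAdd {N : ModuleCat.{u} A} {M : Type u} [AddCommGroup M] (f : N →+ M)
    (hf : ∀ (a : A) (x : N), π a = 0 → f (a • x) = 0) : (splitBaseChange π s).obj N →+ M :=
  QuotientAddGroup.lift (kerMul π.toRingHom N).toAddSubgroup f (by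
    have : idealMul (RingHom.ker π.toRingHom).toAddSubgroup N ≤ f.ker :=
      idealMul_le fun j hj x => hf j x hj
    exact fun z hz => this hz)

/-- The additive maps `N → M` that are linear over `π` factor through `N / I N`. -/
noncomputable def desc {N : ModuleCat.{u} A} {M : ModuleCat.{u} B} (f : N →+ M)
    (hf : ∀ (a : A) (x : N), f (a • x) = π a • f x) (hs : ∀ b, π (s b) = b) :
    (splitBaseChange π s).obj N ⟶ M :=
  ModuleCat.ofHom (X := (splitBaseChange π s).obj N)
    { descAdd π s f fun a x ha => by rw [hf, ha, zero_smul] with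
      map_smul' := fun b x => by
        obtain ⟨x, rfl⟩ := mk_surjective π s N x
        change f (s b • x) = b • f x
        rw [hf, hs] }

variable (hs : ∀ b, π (s b) = b)
include hs

theorem mk_smul (N : ModuleCat.{u} A) (a : A) (x : N) :
    mk π s N (a • x) = π a • mk π s N x := by
  rw [smul_mk, ← sub_eq_zero, ← map_sub, mk_eq_zero, ← sub_smul]
  refine smul_mem_idealMul ?_ x
  change π (a - s (π a)) = 0
  rw [map_sub, hs, sub_self]

/-- Base change preserves projectivity. -/
theorem projective_obj (N : ModuleCat.{u} A) [Projective N] :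
    Projective ((splitBaseChange π s).obj N) where
  factors {E X} f e he := by
    let g : N ⟶ (ModuleCat.restrictScalars π.toRingHom).obj X := ModuleCat.ofHom
      (Y := (ModuleCat.restrictScalars π.toRingHom).obj X)
      { toFun := fun x => f (mk π s N x)
        map_add' := fun x y => by rw [map_add, map_add]; rfl
        map_smul' := fun a x => by
          rw [mk_smul π s hs, map_smul]; rfl }
    let e' := (ModuleCat.restrictScalars π.toRingHom).map e
    have : Epi e' := by
      rw [ModuleCat.epi_iff_surjective] at he ⊢
      exact he
    let l := Projective.factorThru g e'
    have hl (x : N) : e (l x) = f (mk π s N x) :=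
      congrArg (fun φ : N ⟶ (ModuleCat.restrictScalars π.toRingHom).obj X => φ x)
        (Projective.factorThru_comp g e')
    refine ⟨desc π s (M := E) l.hom.toAddMonoidHom (fun a x => l.hom.map_smul a x) hs, ?_⟩
    apply ModuleCat.hom_ext
    refine LinearMap.ext fun x => ?_
    obtain ⟨x, rfl⟩ := mk_surjective π s N x
    exact hl x

/-- The map `𝟙 ⊗_B (N / I N) → 𝟙 ⊗_A N`. -/
noncomputable def trivialTensorHom (ε : B →ₐ[k] k) (N : ModuleCat.{u} A) :
    (trivialTensor ε).obj ((splitBaseChange π s).obj N) ⟶ (trivialTensor (ε.comp π)).obj N :=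
  trivialTensor.lift ε
    (descAdd π s (trivialTensor.mk (ε.comp π) N) fun a x ha => by
      rw [trivialTensor.mk_smul, AlgHom.comp_apply, ha, map_zero, zero_smul])
    (by
      intro b x
      obtain ⟨x, rfl⟩ := mk_surjective π s N x
      change trivialTensor.mk (ε.comp π) N (s b • x) = ε b • trivialTensor.mk (ε.comp π) N x
      rw [trivialTensor.mk_smul, AlgHom.comp_apply, hs])

theorem trivialTensorHom_mk (ε : B →ₐ[k] k) (N : ModuleCat.{u} A) (x : N) :
    trivialTensorHom π s hs ε N (trivialTensor.mk ε _ (mk π s N x)) =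
      trivialTensor.mk (ε.comp π) N x :=
  trivialTensor.lift_mk ε _ _ _

/-- The map `𝟙 ⊗_A N → 𝟙 ⊗_B (N / I N)`. -/
noncomputable def trivialTensorInv (ε : B →ₐ[k] k) (N : ModuleCat.{u} A) :
    (trivialTensor (ε.comp π)).obj N ⟶ (trivialTensor ε).obj ((splitBaseChange π s).obj N) :=
  trivialTensor.lift (ε.comp π)
    ((trivialTensor.mk ε ((splitBaseChange π s).obj N)).comp (mk π s N)) (by
      intro a x
      simp only [AddMonoidHom.comp_apply]
      rw [mk_smul π s hs, trivialTensor.mk_smul]; rfl)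

theorem trivialTensorInv_mk (ε : B →ₐ[k] k) (N : ModuleCat.{u} A) (x : N) :
    trivialTensorInv π s hs ε N (trivialTensor.mk (ε.comp π) N x) =
      trivialTensor.mk ε _ (mk π s N x) :=
  trivialTensor.lift_mk (ε.comp π) _ _ _

/-- `𝟙 ⊗_B (N / I N) ≅ 𝟙 ⊗_A N` when `A` acts on `𝟙` through `B`. -/
noncomputable def trivialTensorIso (ε : B →ₐ[k] k) :
    splitBaseChange π s ⋙ trivialTensor ε ≅ trivialTensor (ε.comp π) :=
  NatIso.ofComponents
    (fun N =>
      { hom := trivialTensorHom π s hs ε N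
        inv := trivialTensorInv π s hs ε N
        hom_inv_id := by
          refine trivialTensor.hom_ext ε fun x => ?_
          obtain ⟨x, rfl⟩ := mk_surjective π s N x
          rw [ModuleCat.comp_apply, trivialTensorHom_mk, trivialTensorInv_mk]
          rfl
        inv_hom_id := by
          refine trivialTensor.hom_ext _ fun x => ?_
          rw [ModuleCat.comp_apply, trivialTensorInv_mk, trivialTensorHom_mk]
          rfl })
    (by
      intro N N' f
      refine trivialTensor.hom_ext ε fun x => ?_
      obtain ⟨x, rfl⟩ := mk_surjective π s N x
      rw [ModuleCat.comp_apply, ModuleCat.comp_apply]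
      have h1 : (splitBaseChange π s ⋙ trivialTensor ε).map f
          (trivialTensor.mk ε _ (mk π s N x)) = trivialTensor.mk ε _ (mk π s N' (f x)) := by
        rw [Functor.comp_map, trivialTensor.mk_naturality, map_mk]
      refine (congrArg _ h1).trans ?_
      refine (trivialTensorHom_mk π s hs ε N' (f x)).trans ?_
      refine Eq.trans ?_ (congrArg ((trivialTensor (ε.comp π)).map f)
        (trivialTensorHom_mk π s hs ε N x)).symm
      rw [trivialTensor.mk_naturality])

end splitBaseChange

end BaseChange

/-! ### Transfer of projective resolutions along a split quotient -/

section Transfer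

/-- A chain complex of projective modules that is exact in positive degrees, with an
augmentation onto its cokernel, is a projective resolution. -/
noncomputable def projectiveResolutionOfExact {B : Type u} [Ring B] {Z : ModuleCat.{u} B}
    (C : ChainComplex (ModuleCat.{u} B) ℕ) (hC : ∀ n, Projective (C.X n)) (p : C.X 0 ⟶ Z)
    (hp : C.d 1 0 ≫ p = 0) (hsurj : Function.Surjective p)
    (h0 : ∀ z, p z = 0 → ∃ w, C.d 1 0 w = z)
    (h1 : ∀ i z, C.d (i + 1) i z = 0 → ∃ w, C.d (i + 2) (i + 1) w = z) :
    ProjectiveResolution Z where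
  complex := C
  projective := hC
  π := (ChainComplex.toSingle₀Equiv _ _).symm ⟨p, hp⟩
  quasiIso := ⟨fun n => by
    cases n with
    | zero =>
      rw [ChainComplex.quasiIsoAt₀_iff, ShortComplex.quasiIso_iff_of_zeros']
      · refine (ShortComplex.exact_and_epi_g_iff_of_iso
          (S₁ := ShortComplex.mk (C.d 1 0) p hp) ?_).1
          ⟨(ShortComplex.moduleCat_exact_iff _).2 h0, (ModuleCat.epi_iff_surjective _).2 hsurj⟩
        exact ShortComplex.isoMk (Iso.refl _) (Iso.refl _) (Iso.refl _)
          ((Category.id_comp _).trans (Category.comp_id _).symm)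
          ((Category.id_comp _).trans (Category.comp_id _).symm)
      all_goals first | rfl | exact C.shape 0 0 (by simp)
    | succ n =>
      rw [quasiIsoAt_iff_exactAt' _ _ (ChainComplex.exactAt_succ_single_obj _ _),
        HomologicalComplex.exactAt_iff' _ (n + 1 + 1) (n + 1) n (by simp) (by simp),
        ShortComplex.moduleCat_exact_iff]
      exact h1 n⟩

variable {k : Type u} [CommRing k] {A B : Type u} [Ring A] [Algebra k A] [Ring B] [Algebra k B]

/-- The subcomplex `J · C` of a chain complex `C` of `A`-modules is exact, including in
degree zero. -/
def IsAcyclicOn (C : ChainComplex (ModuleCat.{u} A) ℕ) (J : AddSubgroup A) : Prop :=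
  (∀ z ∈ idealMul J (C.X 0), ∃ w ∈ idealMul J (C.X 1), C.d 1 0 w = z) ∧
    ∀ i, ∀ z ∈ idealMul J (C.X (i + 1)), C.d (i + 1) i z = 0 →
      ∃ w ∈ idealMul J (C.X (i + 2)), C.d (i + 2) (i + 1) w = z

theorem isAcyclicOn_bot (C : ChainComplex (ModuleCat.{u} A) ℕ) : IsAcyclicOn C ⊥ := by
  have hbot (N : Type u) [AddCommGroup N] [Module A N] (z : N)
      (hz : z ∈ idealMul (⊥ : AddSubgroup A) N) : z = 0 := by
    have : idealMul (⊥ : AddSubgroup A) N ≤ ⊥ :=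
      idealMul_le fun j hj x => by
        rw [AddSubgroup.mem_bot.1 hj, zero_smul]
        exact zero_mem _
    exact this hz
  refine ⟨fun z hz => ⟨0, zero_mem _, ?_⟩, fun i z hz _ => ⟨0, zero_mem _, ?_⟩⟩
  · rw [hbot _ z hz, map_zero]
  · rw [hbot _ z hz, map_zero]

/-- The augmentation of a projective resolution, with values in the module itself. -/
noncomputable def resolutionAug {Z : ModuleCat.{u} A} (P : ProjectiveResolution Z) :
    P.complex.X 0 ⟶ Z := P.π.f 0

theorem resolutionAug_surjective {Z : ModuleCat.{u} A} (P : ProjectiveResolution Z) :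
    Function.Surjective (resolutionAug P) :=
  (ModuleCat.epi_iff_surjective (P.π.f 0)).1 inferInstance

theorem d_comp_resolutionAug {Z : ModuleCat.{u} A} (P : ProjectiveResolution Z)
    (z : P.complex.X 1) : resolutionAug P (P.complex.d 1 0 z) = 0 := by
  have := congrArg (fun f : P.complex.X 1 ⟶ Z => f z) P.complex_d_comp_π_f_zero
  exact this

theorem exists_d_eq_zero {Z : ModuleCat.{u} A} (P : ProjectiveResolution Z) (z : P.complex.X 0)
    (hz : resolutionAug P z = 0) : ∃ w, P.complex.d 1 0 w = z :=
  (ShortComplex.moduleCat_exact_iff _).1 P.exact₀ z hz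

theorem exists_d_eq_succ {Z : ModuleCat.{u} A} (P : ProjectiveResolution Z) (i : ℕ)
    (z : P.complex.X (i + 1)) (hz : P.complex.d (i + 1) i z = 0) :
    ∃ w, P.complex.d (i + 2) (i + 1) w = z :=
  (ShortComplex.moduleCat_exact_iff _).1 (P.exact_succ i) z hz

theorem d_d_apply (C : ChainComplex (ModuleCat.{u} A) ℕ) (i j l : ℕ) (z : C.X i) :
    C.d j l (C.d i j z) = 0 := by
  have := congrArg (fun f : C.X i ⟶ C.X l => f z) (C.d_comp_d i j l)
  exact this

variable (π : A →ₐ[k] B) (s : B →ₐ[k] A) (ε : B →ₐ[k] k)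

/-- If `I P` is exact for a projective resolution `P` of `𝟙` over `A`, then `P / I P` is a
projective resolution of `𝟙` over `B`. -/
noncomputable def baseChangeResolution (hs : ∀ b, π (s b) = b)
    (P : ProjectiveResolution (ModuleCat.of A (TrivialModule (ε.comp π))))
    (hP : IsAcyclicOn P.complex (RingHom.ker π.toRingHom).toAddSubgroup) :
    ProjectiveResolution (ModuleCat.of B (TrivialModule ε)) :=
  let p : (splitBaseChange π s).obj (P.complex.X 0) ⟶ ModuleCat.of B (TrivialModule ε) :=
    splitBaseChange.desc π s (M := ModuleCat.of B (TrivialModule ε))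
      (show P.complex.X 0 →+ TrivialModule ε from (resolutionAug P).hom.toAddMonoidHom)
      (fun a x => (resolutionAug P).hom.map_smul a x) hs
  have hmap (i j : ℕ) (x) : (((splitBaseChange π s).mapHomologicalComplex _).obj P.complex).d i j
      (splitBaseChange.mk π s _ x) = splitBaseChange.mk π s _ (P.complex.d i j x) := rfl
  projectiveResolutionOfExact
    (((splitBaseChange π s).mapHomologicalComplex _).obj P.complex)
    (fun n => splitBaseChange.projective_obj π s hs (P.complex.X n)) p
    (by
      apply ModuleCat.hom_ext
      refine LinearMap.ext fun x => ?_
      obtain ⟨x, rfl⟩ := splitBaseChange.mk_surjective π s _ x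
      exact d_comp_resolutionAug P x)
    (fun y => by
      obtain ⟨x, hx⟩ := resolutionAug_surjective P y
      exact ⟨splitBaseChange.mk π s _ x, hx⟩)
    (fun z hz => by
      obtain ⟨x, rfl⟩ := splitBaseChange.mk_surjective π s _ z
      obtain ⟨w, hw⟩ := exists_d_eq_zero P x hz
      refine ⟨splitBaseChange.mk π s _ w, ?_⟩
      rw [hmap, hw])
    (fun i z hz => by
      obtain ⟨x, rfl⟩ := splitBaseChange.mk_surjective π s _ z
      rw [hmap] at hz
      have hz' : P.complex.d (i + 1) i x ∈ idealMul (RingHom.ker π.toRingHom).toAddSubgroup _ :=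
        (splitBaseChange.mk_eq_zero π s).1 hz
      -- correct `x` by an element of `I P` so that it becomes a cycle
      obtain ⟨w, hw, hdw⟩ : ∃ w ∈ idealMul (RingHom.ker π.toRingHom).toAddSubgroup
          (P.complex.X (i + 1)), P.complex.d (i + 1) i w = P.complex.d (i + 1) i x := by
        cases i with
        | zero => exact hP.1 _ hz'
        | succ i => exact hP.2 i _ hz' (d_d_apply _ _ _ _ _)
      obtain ⟨v, hv⟩ := exists_d_eq_succ P i (x - w) (by rw [map_sub, hdw, sub_self])
      refine ⟨splitBaseChange.mk π s _ v, ?_⟩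
      rw [hmap, hv, map_sub, (splitBaseChange.mk_eq_zero π s).2 hw, sub_zero])

/-- Let `π : A → B` be a split surjection of algebras with kernel `I`. If `I P` is exact for some
projective resolution `P` of `𝟙` over `A`, then `A` and `B` have the same `Tor(𝟙, 𝟙)`. -/
theorem torTrivial_iso_of_isAcyclicOn (hs : ∀ b, π (s b) = b)
    (P : ProjectiveResolution (ModuleCat.of A (TrivialModule (ε.comp π))))
    (hP : IsAcyclicOn P.complex (RingHom.ker π.toRingHom).toAddSubgroup) (i : ℕ) :
    Nonempty (torTrivial (ε.comp π) i ≅ torTrivial ε i) := by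
  refine ⟨P.isoLeftDerivedObj (trivialTensor (ε.comp π)) i ≪≫ ?_ ≪≫
    ((baseChangeResolution π s ε hs P hP).isoLeftDerivedObj (trivialTensor ε) i).symm⟩
  refine (HomologicalComplex.homologyFunctor _ _ i).mapIso ?_
  exact ((NatIso.mapHomologicalComplex (splitBaseChange.trivialTensorIso π s hs ε)
    (ComplexShape.down ℕ)).symm.app P.complex)

/-- Isomorphic augmented algebras have the same `Tor(𝟙, 𝟙)`. -/
theorem torTrivial_iso_of_algEquiv (e : A ≃ₐ[k] B) (ε : B →ₐ[k] k) (i : ℕ) :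
    Nonempty (torTrivial (ε.comp e.toAlgHom) i ≅ torTrivial ε i) := by
  let P := ProjectiveResolution.of (ModuleCat.of A (TrivialModule (ε.comp e.toAlgHom)))
  have hker : (RingHom.ker e.toAlgHom.toRingHom).toAddSubgroup = ⊥ := by
    refine (AddSubgroup.eq_bot_iff_forall _).2 fun a ha => ?_
    exact (map_eq_zero_iff e e.injective).1 ha
  refine torTrivial_iso_of_isAcyclicOn e.toAlgHom e.symm.toAlgHom ε
    (fun b => e.apply_symm_apply b) P ?_ i
  rw [hker]
  exact isAcyclicOn_bot _

end Transfer

/-! ### `Tor` over a group algebra and group homology -/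

section GroupHomology

variable {k H : Type u} [CommRing k] [Group H]

theorem groupAlgebraAugmentation_single (h : H) (c : k) :
    groupAlgebraAugmentation k H (MonoidAlgebra.single h c) = c := by
  simp [groupAlgebraAugmentation]

/-- An additive map out of a `k[H]`-module is linear over the augmentation as soon as it is
`k`-linear and invariant under `H`. -/
theorem map_smul_of_single {M V : Type u} [AddCommGroup M] [Module (MonoidAlgebra k H) M]
    [AddCommGroup V] [Module k V] (f : M →+ V)
    (hf : ∀ (h : H) (c : k) (x : M), f (MonoidAlgebra.single h c • x) = c • f x)
    (a : MonoidAlgebra k H) (x : M) : f (a • x) = groupAlgebraAugmentation k H a • f x := by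
  induction a using MonoidAlgebra.induction_linear with
  | zero => simp
  | add a b ha hb => rw [add_smul, map_add, ha, hb, map_add, add_smul]
  | single h c => rw [hf, groupAlgebraAugmentation_single]

open Rep

/-- The identity of the additive group underlying a representation, viewed as a map to the
corresponding module over the group algebra. -/
def toModuleAddEquiv (V : Rep.{u} k H) : V ≃+ (toModuleMonoidAlgebra.obj V) :=
  V.ρ.asModuleEquiv.symm.toAddEquiv

theorem single_smul_toModuleAddEquiv (V : Rep.{u} k H) (h : H) (c : k) (x : V) :
    (MonoidAlgebra.single h c : MonoidAlgebra k H) • toModuleAddEquiv V x =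
      toModuleAddEquiv V (c • V.ρ h x) :=
  Representation.single_smul _ _ _ (V.ρ.asModuleEquiv.symm x)

theorem coinvariantsTensorMk_rho (V : Rep.{u} k H) (h : H) (c : k) (x : V) :
    coinvariantsTensorMk (Rep.trivial k H k) V c (V.ρ h x) =
      coinvariantsTensorMk (Rep.trivial k H k) V c x :=
  Representation.Coinvariants.mk_self_apply ((Rep.trivial k H k).ρ.tprod V.ρ) h (c ⊗ₜ x)

/-- The functor `V ↦ 𝟙 ⊗_{k[H]} V` on representations of `H`. -/
noncomputable abbrev repTrivialTensor (k H : Type u) [CommRing k] [Group H] :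
    Rep.{u} k H ⥤ ModuleCat.{u} k :=
  toModuleMonoidAlgebra ⋙ trivialTensor (groupAlgebraAugmentation k H)

/-- The universal map `V → 𝟙 ⊗_{k[H]} V`. -/
noncomputable def repTrivialTensorMk (V : Rep.{u} k H) :
    V →ₗ[k] (repTrivialTensor k H).obj V :=
  { (trivialTensor.mk (groupAlgebraAugmentation k H) (toModuleMonoidAlgebra.obj V)).comp
      (toModuleAddEquiv V).toAddMonoidHom with
    map_smul' := fun c x => by
      have := trivialTensor.mk_smul (groupAlgebraAugmentation k H) (toModuleMonoidAlgebra.obj V)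
        (MonoidAlgebra.single 1 c) (toModuleAddEquiv V x)
      rw [groupAlgebraAugmentation_single, single_smul_toModuleAddEquiv, map_one] at this
      exact this }

theorem repTrivialTensorMk_rho (V : Rep.{u} k H) (h : H) (x : V) :
    repTrivialTensorMk V (V.ρ h x) = repTrivialTensorMk V x := by
  have := trivialTensor.mk_smul (groupAlgebraAugmentation k H) (toModuleMonoidAlgebra.obj V)
    (MonoidAlgebra.single h 1) (toModuleAddEquiv V x)
  rw [groupAlgebraAugmentation_single, single_smul_toModuleAddEquiv, one_smul, one_smul] at this
  exact this

theorem repTrivialTensor_hom_ext {V : Rep.{u} k H} {W : ModuleCat.{u} k}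
    {f g : (repTrivialTensor k H).obj V ⟶ W}
    (h : ∀ x, f (repTrivialTensorMk V x) = g (repTrivialTensorMk V x)) : f = g := by
  refine trivialTensor.hom_ext _ fun x => ?_
  obtain ⟨x, rfl⟩ := (toModuleAddEquiv V).surjective x
  exact h x

/-- The map `𝟙 ⊗_{k[H]} V → (k ⊗ V)_H`. -/
noncomputable def repTrivialTensorHom (V : Rep.{u} k H) :
    (repTrivialTensor k H).obj V ⟶
      ((coinvariantsTensor k H).obj (Rep.trivial k H k)).obj V :=
  trivialTensor.lift _
    ((coinvariantsTensorMk (Rep.trivial k H k) V (1 : k)).toAddMonoidHom.comp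
      (toModuleAddEquiv V).symm.toAddMonoidHom)
    (map_smul_of_single _ fun h c x => by
      obtain ⟨x, rfl⟩ := (toModuleAddEquiv V).surjective x
      rw [single_smul_toModuleAddEquiv]
      change coinvariantsTensorMk (Rep.trivial k H k) V (1 : k) (c • V.ρ h x) =
        c • coinvariantsTensorMk (Rep.trivial k H k) V (1 : k) x
      rw [map_smul, coinvariantsTensorMk_rho])

theorem repTrivialTensorHom_mk (V : Rep.{u} k H) (x : V) :
    repTrivialTensorHom V (repTrivialTensorMk V x) =
      coinvariantsTensorMk (Rep.trivial k H k) V (1 : k) x :=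
  trivialTensor.lift_mk _ _ _ _

/-- The map `(k ⊗ V)_H → 𝟙 ⊗_{k[H]} V`. -/
noncomputable def repTrivialTensorInv (V : Rep.{u} k H) :
    ((coinvariantsTensor k H).obj (Rep.trivial k H k)).obj V ⟶
      (repTrivialTensor k H).obj V :=
  ModuleCat.ofHom (X := Representation.Coinvariants ((Rep.trivial k H k).ρ.tprod V.ρ))
    (Representation.Coinvariants.lift ((Rep.trivial k H k).ρ.tprod V.ρ)
      (TensorProduct.lift ((LinearMap.lsmul k
        (V →ₗ[k] (repTrivialTensor k H).obj V)).flip (repTrivialTensorMk V)))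
      (fun h => by
        refine TensorProduct.ext' fun c x => ?_
        change c • repTrivialTensorMk V (V.ρ h x) = c • repTrivialTensorMk V x
        rw [repTrivialTensorMk_rho]))

theorem repTrivialTensorInv_mk (V : Rep.{u} k H) (c : k) (x : V) :
    repTrivialTensorInv V (coinvariantsTensorMk (Rep.trivial k H k) V c x) =
      c • repTrivialTensorMk V x := rfl

/-- `𝟙 ⊗_{k[H]} V` agrees with the coinvariants of `k ⊗ V`. -/
noncomputable def repTrivialTensorIso :
    repTrivialTensor k H ≅ (coinvariantsTensor k H).obj (Rep.trivial k H k) :=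
  NatIso.ofComponents
    (fun V =>
      { hom := repTrivialTensorHom V
        inv := repTrivialTensorInv V
        hom_inv_id := by
          refine repTrivialTensor_hom_ext fun x => ?_
          rw [ModuleCat.comp_apply, repTrivialTensorHom_mk, repTrivialTensorInv_mk, one_smul]
          rfl
        inv_hom_id := by
          refine coinvariantsTensor_hom_ext (LinearMap.ext fun c => LinearMap.ext fun x => ?_)
          change repTrivialTensorHom V (repTrivialTensorInv V
            (coinvariantsTensorMk (Rep.trivial k H k) V c x)) =
              coinvariantsTensorMk (Rep.trivial k H k) V c x
          rw [repTrivialTensorInv_mk, map_smul, repTrivialTensorHom_mk, ← LinearMap.smul_apply,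
            ← map_smul, smul_eq_mul, mul_one] })
    (by
      intro V W f
      refine repTrivialTensor_hom_ext fun x => ?_
      rw [ModuleCat.comp_apply, ModuleCat.comp_apply]
      refine Eq.trans (repTrivialTensorHom_mk W (f.hom x)) ?_
      refine Eq.trans ?_ (congrArg _ (repTrivialTensorHom_mk V x)).symm
      rfl)

/-- The trivial representation, as a module over the group algebra. -/
noncomputable def toModuleTrivialIso (k H : Type u) [CommRing k] [Group H] :
    toModuleMonoidAlgebra.obj (Rep.trivial k H k) ≅
      ModuleCat.of (MonoidAlgebra k H) (TrivialModule (groupAlgebraAugmentation k H)) :=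
  LinearEquiv.toModuleIso
    { (toModuleAddEquiv (Rep.trivial k H k)).symm with
      map_smul' := map_smul_of_single (V := k)
        (toModuleAddEquiv (Rep.trivial k H k)).symm.toAddMonoidHom fun h c x => by
        obtain ⟨x, rfl⟩ := (toModuleAddEquiv (Rep.trivial k H k)).surjective x
        rw [single_smul_toModuleAddEquiv]
        rfl }

/-- `Tor` over a group algebra between trivial modules is group homology with trivial
coefficients. -/
theorem torTrivial_iso_groupHomology (i : ℕ) :
    Nonempty (torTrivial (groupAlgebraAugmentation k H) i ≅
      groupHomology (Rep.trivial k H k) i) := by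
  classical
  let P := barResolution k H
  have : (toModuleMonoidAlgebra (k := k) (G := H)).Additive := { map_add := fun {_ _ _ _} => rfl }
  let Q := (toModuleMonoidAlgebra (k := k) (G := H)).mapProjectiveResolution P
  refine ⟨((trivialTensor (groupAlgebraAugmentation k H)).leftDerived i).mapIso
    (toModuleTrivialIso k H).symm ≪≫
    Q.isoLeftDerivedObj (trivialTensor (groupAlgebraAugmentation k H)) i ≪≫ ?_ ≪≫
    (groupHomologyIso (Rep.trivial k H k) i P).symm⟩
  refine (HomologicalComplex.homologyFunctor _ _ i).mapIso ?_
  exact (NatIso.mapHomologicalComplex (repTrivialTensorIso (k := k) (H := H))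
    (ComplexShape.down ℕ)).app P.complex

end GroupHomology

/-! ### Exactness of `J · P` for sums of right ideals -/

section Acyclicity

variable {A : Type u} [Ring A]

/-- An additive subgroup that is closed under multiplication from the right. -/
def IsRightIdeal (J : AddSubgroup A) : Prop := ∀ j ∈ J, ∀ a : A, j * a ∈ J

theorem IsRightIdeal.sup {J J' : AddSubgroup A} (hJ : IsRightIdeal J) (hJ' : IsRightIdeal J') :
    IsRightIdeal (J ⊔ J') := by
  intro j hj a
  obtain ⟨x, hx, y, hy, rfl⟩ := AddSubgroup.mem_sup.1 hj
  rw [add_mul]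
  exact AddSubgroup.add_mem_sup (hJ x hx a) (hJ' y hy a)

theorem IsRightIdeal.inf {J J' : AddSubgroup A} (hJ : IsRightIdeal J) (hJ' : IsRightIdeal J') :
    IsRightIdeal (J ⊓ J') :=
  fun j hj a => AddSubgroup.mem_inf.2 ⟨hJ j hj.1 a, hJ' j hj.2 a⟩

/-- In terms of a section `σ` of `A^(N) → N`, the subgroup `J · N` consists of the elements whose
coordinates lie in `J`. -/
theorem mem_idealMul_iff {N : Type u} [AddCommGroup N] [Module A N] (σ : N →ₗ[A] N →₀ A)
    (hσ : ∀ z, Finsupp.linearCombination A id (σ z) = z) {J : AddSubgroup A}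
    (hJ : IsRightIdeal J) (z : N) : z ∈ idealMul J N ↔ ∀ x, σ z x ∈ J := by
  constructor
  · intro hz x
    have : idealMul J N ≤ J.comap ((Finsupp.applyAddHom x).comp σ.toAddMonoidHom) :=
      idealMul_le fun j hj y => by
        change σ (j • y) x ∈ J
        rw [map_smul, Finsupp.smul_apply]
        exact hJ j hj _
    exact this hz
  · intro h
    rw [← hσ z, Finsupp.linearCombination_apply]
    exact AddSubgroup.sum_mem _ fun x _ => smul_mem_idealMul (h x) _

/-- `J · N ∩ J' · N = (J ∩ J') · N` for projective `N`. -/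
theorem mem_idealMul_inf {N : Type u} [AddCommGroup N] [Module A N] [Module.Projective A N]
    {J J' : AddSubgroup A} (hJ : IsRightIdeal J) (hJ' : IsRightIdeal J') {z : N}
    (hz : z ∈ idealMul J N) (hz' : z ∈ idealMul J' N) : z ∈ idealMul (J ⊓ J') N := by
  obtain ⟨σ, hσ⟩ := Module.Projective.out (R := A) (P := N)
  refine (mem_idealMul_iff σ hσ (hJ.inf hJ') z).2 fun x => AddSubgroup.mem_inf.2 ⟨?_, ?_⟩
  · exact (mem_idealMul_iff σ hσ hJ z).1 hz x
  · exact (mem_idealMul_iff σ hσ hJ' z).1 hz' x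

theorem exists_add_of_mem_idealMul_sup {N : Type u} [AddCommGroup N] [Module A N]
    {J J' : AddSubgroup A} {z : N} (hz : z ∈ idealMul (J ⊔ J') N) :
    ∃ x ∈ idealMul J N, ∃ y ∈ idealMul J' N, x + y = z := by
  have : idealMul (J ⊔ J') N ≤ idealMul J N ⊔ idealMul J' N := idealMul_le fun j hj x => by
    obtain ⟨a, ha, b, hb, rfl⟩ := AddSubgroup.mem_sup.1 hj
    rw [add_smul]
    exact AddSubgroup.add_mem_sup (smul_mem_idealMul ha x) (smul_mem_idealMul hb x)
  exact AddSubgroup.mem_sup.1 (this hz)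

/-- If `J = e A` for an idempotent `e` that annihilates `Z`, then `J · P = e P` is a direct summand
of a resolution `P` of `Z` that is exact in all degrees. -/
theorem isAcyclicOn_of_idempotent {Z : ModuleCat.{u} A} (P : ProjectiveResolution Z)
    {J : AddSubgroup A} (e : A) (he : ∀ j ∈ J, e * j = j) (heJ : ∀ a, e * a ∈ J)
    (heZ : ∀ z : Z, e • z = 0) : IsAcyclicOn P.complex J := by
  have heN (N : Type u) [AddCommGroup N] [Module A N] (z : N) (hz : z ∈ idealMul J N) :
      e • z = z := by
    have : idealMul J N ≤ (DistribSMul.toAddMonoidHom N e).eqLocus (AddMonoidHom.id N) :=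
      idealMul_le fun j hj x => by
        change e • j • x = j • x
        rw [smul_smul, he j hj]
    exact this hz
  have heM (N : Type u) [AddCommGroup N] [Module A N] (z : N) : e • z ∈ idealMul J N := by
    have : e ∈ J := by simpa using heJ 1
    exact smul_mem_idealMul this z
  constructor
  · intro z hz
    obtain ⟨w, hw⟩ := exists_d_eq_zero P z (by rw [← heN _ z hz, map_smul]; exact heZ _)
    exact ⟨e • w, heM _ w, by rw [map_smul, hw, heN _ z hz]⟩
  · intro i z hz hdz
    obtain ⟨w, hw⟩ := exists_d_eq_succ P i z hdz
    exact ⟨e • w, heM _ w, by rw [map_smul, hw, heN _ z hz]⟩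

/-- The Mayer–Vietoris argument for `J · C` and `J' · C` inside a complex of projectives. -/
theorem IsAcyclicOn.sup {C : ChainComplex (ModuleCat.{u} A) ℕ}
    (hC : ∀ n, Module.Projective A (C.X n)) {J J' : AddSubgroup A} (hJ : IsRightIdeal J)
    (hJ' : IsRightIdeal J') (h : IsAcyclicOn C J) (h' : IsAcyclicOn C J')
    (hinf : IsAcyclicOn C (J ⊓ J')) : IsAcyclicOn C (J ⊔ J') := by
  constructor
  · intro z hz
    obtain ⟨x, hx, y, hy, rfl⟩ := exists_add_of_mem_idealMul_sup hz
    obtain ⟨v, hv, rfl⟩ := h.1 x hx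
    obtain ⟨w, hw, rfl⟩ := h'.1 y hy
    exact ⟨v + w, add_mem (idealMul_mono le_sup_left hv) (idealMul_mono le_sup_right hw),
      map_add _ _ _⟩
  · intro i z hz hdz
    obtain ⟨x, hx, y, hy, rfl⟩ := exists_add_of_mem_idealMul_sup hz
    rw [map_add] at hdz
    -- the common boundary of the two parts bounds inside the intersection
    have hmem : C.d (i + 1) i x ∈ idealMul (J ⊓ J') (C.X i) := by
      refine mem_idealMul_inf hJ hJ' (map_mem_idealMul (C.d (i + 1) i).hom hx) ?_
      rw [eq_neg_of_add_eq_zero_left hdz]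
      exact neg_mem (map_mem_idealMul (C.d (i + 1) i).hom hy)
    obtain ⟨u, hu, hdu⟩ : ∃ u ∈ idealMul (J ⊓ J') (C.X (i + 1)),
        C.d (i + 1) i u = C.d (i + 1) i x := by
      cases i with
      | zero => exact hinf.1 _ hmem
      | succ i => exact hinf.2 i _ hmem (d_d_apply _ _ _ _ _)
    obtain ⟨v, hv, hdv⟩ := h.2 i (x - u) (sub_mem hx (idealMul_mono inf_le_left hu))
      (by rw [map_sub, hdu, sub_self])
    obtain ⟨w, hw, hdw⟩ := h'.2 i (y + u) (add_mem hy (idealMul_mono inf_le_right hu))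
      (by rw [map_add, hdu, add_comm, hdz])
    refine ⟨v + w, add_mem (idealMul_mono le_sup_left hv) (idealMul_mono le_sup_right hw), ?_⟩
    rw [map_add, hdv, hdw]
    abel

/-- Exactness of `J · C` for all members of a family of right ideals, indexed by a family of sets
closed under intersection, passes to finite unions. -/
theorem isAcyclicOn_foldr_union {D : Type*} (J : Set D → AddSubgroup A) (hbot : J ∅ = ⊥)
    (hsup : ∀ S T, J (S ∪ T) = J S ⊔ J T) (hinf : ∀ S T, J (S ∩ T) = J S ⊓ J T)
    {C : ChainComplex (ModuleCat.{u} A) ℕ} (hC : ∀ n, Module.Projective A (C.X n))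
    (𝓛 : Set (Set D)) (h𝓛 : ∀ S ∈ 𝓛, ∀ T ∈ 𝓛, S ∩ T ∈ 𝓛) (hJ : ∀ S ∈ 𝓛, IsRightIdeal (J S))
    (hacyc : ∀ S ∈ 𝓛, IsAcyclicOn C (J S)) (m : ℕ) :
    ∀ l : List (Set D), l.length = m → (∀ S ∈ l, S ∈ 𝓛) →
      IsRightIdeal (J (l.foldr (· ∪ ·) ∅)) ∧ IsAcyclicOn C (J (l.foldr (· ∪ ·) ∅)) := by
  induction m with
  | zero =>
    intro l hl _
    rw [List.length_eq_zero_iff.1 hl, List.foldr_nil, hbot]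
    refine ⟨fun j hj a => ?_, isAcyclicOn_bot C⟩
    rw [AddSubgroup.mem_bot.1 hj, zero_mul]
    exact zero_mem _
  | succ m ih =>
    intro l hl hl𝓛
    obtain ⟨T, l, rfl⟩ := List.exists_cons_of_length_eq_add_one hl
    have hlm : l.length = m := by simpa using hl
    have hT : T ∈ 𝓛 := hl𝓛 T (by simp)
    have hl' : ∀ S ∈ l, S ∈ 𝓛 := fun S hS => hl𝓛 S (by simp [hS])
    obtain ⟨h1, h2⟩ := ih l hlm hl'
    have hmap : T ∩ l.foldr (· ∪ ·) ∅ = (l.map (T ∩ ·)).foldr (· ∪ ·) ∅ := by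
      clear hl hlm hl𝓛 hl' h1 h2
      induction l with
      | nil => simp
      | cons S l ih => simp only [List.foldr_cons, List.map_cons, Set.inter_union_distrib_left, ih]
    have h3 := (ih (l.map (T ∩ ·)) (by simpa using hlm) (by
      intro S hS
      obtain ⟨S', hS', rfl⟩ := List.mem_map.1 hS
      exact h𝓛 T hT S' (hl' S' hS'))).2
    rw [← hmap, hinf] at h3
    rw [List.foldr_cons, hsup]
    exact ⟨(hJ T hT).sup h1, IsAcyclicOn.sup hC (hJ T hT) h1 (hacyc T hT) h2 h3⟩

/-- Exactness of `I · C` can be tested on a family of subgroups that exhausts it. -/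
theorem isAcyclicOn_of_exhaust {C : ChainComplex (ModuleCat.{u} A) ℕ} {I : AddSubgroup A}
    (h : ∀ n, ∀ z ∈ idealMul I (C.X n), ∃ J ≤ I, IsAcyclicOn C J ∧ z ∈ idealMul J (C.X n)) :
    IsAcyclicOn C I := by
  constructor
  · intro z hz
    obtain ⟨J, hJI, hJ, hzJ⟩ := h _ z hz
    obtain ⟨w, hw, hdw⟩ := hJ.1 z hzJ
    exact ⟨w, idealMul_mono hJI hw, hdw⟩
  · intro i z hz hdz
    obtain ⟨J, hJI, hJ, hzJ⟩ := h _ z hz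
    obtain ⟨w, hw, hdw⟩ := hJ.2 i z hzJ hdz
    exact ⟨w, idealMul_mono hJI hw, hdw⟩

end Acyclicity

/-! ### Diagrams containing prescribed left-hand arcs -/

theorem fibreProd_eq_one {E C G : Type*} [CommMonoid G] (f : E → C) (ℓ : E → G) (c : C)
    (h : ∀ e, f e = c → ℓ e = 1) : fibreProd f ℓ c = 1 := by
  unfold fibreProd
  exact finprod_eq_one_of_forall_eq_one fun e => h e e.2

theorem fibreProd_eq_of_unique {E C G : Type*} [CommMonoid G] (f : E → C) (ℓ : E → G) (c : C)
    (e₀ : E) (h₀ : f e₀ = c) (h : ∀ e, f e = c → e = e₀) : fibreProd f ℓ c = ℓ e₀ := by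
  unfold fibreProd
  rw [finprod_eq_single _ (⟨e₀, h₀⟩ : {e : E // f e = c})]
  exact fun e he => absurd (Subtype.ext (h e e.2)) he

namespace GBrauerDiagram

section LeftCone

variable {G : Type u} {n : ℕ}

/-- The diagrams that have the same edges, with the same labels, as `x` at the left-hand nodes
in `D`. -/
def leftCone (x : GBrauerDiagram G n) (D : Set (Fin n)) : Set (GBrauerDiagram G n) :=
  {y | ∀ i ∈ D, y.partner (.inl i) = x.partner (.inl i) ∧ y.label (.inl i) = x.label (.inl i)}

/-- A set of left-hand nodes that is a union of left-to-left arcs of `x`. -/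
def IsLeftClosed (x : GBrauerDiagram G n) (D : Set (Fin n)) : Prop :=
  ∀ i ∈ D, ∃ j ∈ D, x.partner (.inl i) = .inl j

theorem self_mem_leftCone (x : GBrauerDiagram G n) (D : Set (Fin n)) : x ∈ leftCone x D :=
  fun _ _ => ⟨rfl, rfl⟩

theorem IsLeftClosed.congr {x y : GBrauerDiagram G n} {D : Set (Fin n)} (h : IsLeftClosed x D)
    (hy : y ∈ leftCone x D) : IsLeftClosed y D := fun i hi => by
  rw [(hy i hi).1]
  exact h i hi

theorem IsLeftClosed.union {x : GBrauerDiagram G n} {D D' : Set (Fin n)} (h : IsLeftClosed x D)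
    (h' : IsLeftClosed x D') : IsLeftClosed x (D ∪ D') := by
  rintro i (hi | hi)
  · obtain ⟨j, hj, hij⟩ := h i hi
    exact ⟨j, Or.inl hj, hij⟩
  · obtain ⟨j, hj, hij⟩ := h' i hi
    exact ⟨j, Or.inr hj, hij⟩

theorem leftCone_inter {x x' y : GBrauerDiagram G n} {D D' : Set (Fin n)} (h : y ∈ leftCone x D)
    (h' : y ∈ leftCone x' D') : leftCone x D ∩ leftCone x' D' = leftCone y (D ∪ D') := by
  ext z
  constructor
  · rintro ⟨hz, hz'⟩ i (hi | hi)
    · rw [(hz i hi).1, (hz i hi).2, (h i hi).1, (h i hi).2]; exact ⟨rfl, rfl⟩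
    · rw [(hz' i hi).1, (hz' i hi).2, (h' i hi).1, (h' i hi).2]; exact ⟨rfl, rfl⟩
  · intro hz
    refine ⟨fun i hi => ?_, fun i hi => ?_⟩
    · rw [(hz i (Or.inl hi)).1, (hz i (Or.inl hi)).2]; exact h i hi
    · rw [(hz i (Or.inr hi)).1, (hz i (Or.inr hi)).2]; exact h' i hi

variable [CommMonoid G]

theorem mul_partner_inl (x y : GBrauerDiagram G n) {i j : Fin n}
    (h : x.partner (.inl i) = .inl j) : (x * y).partner (.inl i) = .inl j := by
  refine partner_mul_of_outer_eq x y _ _ ?_ (h ▸ x.partner_ne _)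
  change Quot.mk _ (Sum.inl (x.edge (.inl j))) = Quot.mk _ (Sum.inl (x.edge (.inl i)))
  rw [← h, edge_partner]

/-- The component of a left-to-left arc of `x` in the concatenation with `y` consists of this
arc alone. -/
theorem mul_label_inl (x y : GBrauerDiagram G n) {i j : Fin n}
    (h : x.partner (.inl i) = .inl j) : (x * y).label (.inl i) = x.label (.inl i) := by
  rw [mul_label]
  refine fibreProd_eq_of_unique _ _ _ (Sum.inl (x.edge (.inl i))) rfl fun e he => ?_
  let s : Component x y → Prop := Quot.lift (fun e => e = Sum.inl (x.edge (.inl i))) (by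
    rintro _ _ ⟨m⟩
    refine propext ⟨fun hm => ?_, fun hm => by cases hm⟩
    have := (x.edge_eq_iff _ _).1 (Sum.inl_injective hm)
    rw [h] at this
    rcases this with this | this <;> cases this)
  have hs : s (Quot.mk _ e) := by rw [he]; exact rfl
  exact hs

theorem mul_mem_leftCone {x y : GBrauerDiagram G n} {D : Set (Fin n)} (hD : IsLeftClosed x D)
    (hy : y ∈ leftCone x D) (z : GBrauerDiagram G n) : y * z ∈ leftCone x D := by
  intro i hi
  obtain ⟨j, -, hij⟩ := hD i hi
  rw [← (hy i hi).1] at hij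
  rw [mul_partner_inl y z hij, mul_label_inl y z hij, ← (hy i hi).1, hij, (hy i hi).2]
  exact ⟨rfl, rfl⟩

open Classical in
/-- The diagram with the left-to-left arcs of `x` on `D`, the mirror images of these arcs on the
right-hand side with trivial labels, and horizontal edges with trivial labels elsewhere. -/
noncomputable def cupCap (x : GBrauerDiagram G n) (D : Set (Fin n)) (hD : IsLeftClosed x D) :
    GBrauerDiagram G n where
  partner := Sum.elim (fun i => if i ∈ D then x.partner (.inl i) else .inr i)
    (fun i => if i ∈ D then (x.partner (.inl i)).swap else .inl i)
  label := Sum.elim (fun i => if i ∈ D then x.label (.inl i) else 1) (fun _ => 1)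
  partner_partner := by
    rintro (i | i) <;> by_cases hi : i ∈ D
    · obtain ⟨j, hj, hij⟩ := hD i hi
      simp only [Sum.elim_inl, if_pos hi, hij, if_pos hj]
      rw [← hij, x.partner_partner]
    · simp only [Sum.elim_inl, if_neg hi, Sum.elim_inr]
    · obtain ⟨j, hj, hij⟩ := hD i hi
      simp only [Sum.elim_inr, if_pos hi, hij, Sum.swap_inl, if_pos hj]
      rw [← hij, x.partner_partner, Sum.swap_inl]
    · simp only [Sum.elim_inl, if_neg hi, Sum.elim_inr]
  partner_ne := by
    rintro (i | i) <;> by_cases hi : i ∈ D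
    · simp only [Sum.elim_inl, if_pos hi]
      exact x.partner_ne _
    · simp only [Sum.elim_inl, if_neg hi]
      intro h; cases h
    · simp only [Sum.elim_inr, if_pos hi]
      intro h
      refine x.partner_ne (.inl i) ?_
      rw [← Sum.swap_swap (x.partner (.inl i)), h, Sum.swap_inr]
    · simp only [Sum.elim_inr, if_neg hi]
      intro h; cases h
  label_partner := by
    rintro (i | i) <;> by_cases hi : i ∈ D
    · obtain ⟨j, hj, hij⟩ := hD i hi
      simp only [Sum.elim_inl, if_pos hi, hij, if_pos hj]
      rw [← hij, x.label_partner]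
    · simp only [Sum.elim_inl, if_neg hi, Sum.elim_inr]
    · obtain ⟨j, hj, hij⟩ := hD i hi
      simp only [Sum.elim_inr, if_pos hi, hij, Sum.swap_inl]
    · simp only [Sum.elim_inl, if_neg hi, Sum.elim_inr]

section CupCap

variable {x : GBrauerDiagram G n} {D : Set (Fin n)} (hD : IsLeftClosed x D)

theorem cupCap_partner_inl_of_mem {i : Fin n} (hi : i ∈ D) :
    (cupCap x D hD).partner (.inl i) = x.partner (.inl i) := if_pos hi

theorem cupCap_partner_inl_of_notMem {i : Fin n} (hi : i ∉ D) :
    (cupCap x D hD).partner (.inl i) = .inr i := if_neg hi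

theorem cupCap_partner_inr_of_mem {i : Fin n} (hi : i ∈ D) :
    (cupCap x D hD).partner (.inr i) = (x.partner (.inl i)).swap := if_pos hi

theorem cupCap_partner_inr_of_notMem {i : Fin n} (hi : i ∉ D) :
    (cupCap x D hD).partner (.inr i) = .inl i := if_neg hi

theorem cupCap_label_inl_of_mem {i : Fin n} (hi : i ∈ D) :
    (cupCap x D hD).label (.inl i) = x.label (.inl i) := if_pos hi

theorem cupCap_label_inl_of_notMem {i : Fin n} (hi : i ∉ D) :
    (cupCap x D hD).label (.inl i) = 1 := if_neg hi

theorem cupCap_mem_leftCone : cupCap x D hD ∈ leftCone x D := fun _ hi =>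
  ⟨cupCap_partner_inl_of_mem hD hi, cupCap_label_inl_of_mem hD hi⟩

theorem cupCap_edge_inr {i : Fin n} (hi : i ∉ D) :
    (cupCap x D hD).edge (.inr i) = (cupCap x D hD).edge (.inl i) := by
  rw [← cupCap_partner_inl_of_notMem hD hi, edge_partner]

variable {y : GBrauerDiagram G n} (hy : y ∈ leftCone x D)
include hD

/-- The nodes outside `D` lie in the concatenation of `cupCap x D` and `y` on the component of
their edge of `y`. -/
theorem outer_cupCap_of_notMem {v : BrauerNode n} (hv : v ∉ Sum.inl '' D) :
    outer (cupCap x D hD) y v = Quot.mk _ (.inr (y.edge v)) := by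
  rcases v with i | i
  · have hi : i ∉ D := fun h => hv ⟨i, h, rfl⟩
    change Quot.mk _ (Sum.inl ((cupCap x D hD).edge (.inl i))) = _
    rw [← cupCap_edge_inr hD hi]
    exact Quot.sound (Joined.middle i)
  · rfl

include hy

omit [CommMonoid G] in
theorem partner_mem_iff (v : BrauerNode n) :
    y.partner v ∈ (Sum.inl '' D : Set (BrauerNode n)) ↔ v ∈ (Sum.inl '' D : Set (BrauerNode n)) := by
  have key : ∀ v, v ∈ (Sum.inl '' D : Set (BrauerNode n)) →
      y.partner v ∈ (Sum.inl '' D : Set (BrauerNode n)) := by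
    rintro _ ⟨i, hi, rfl⟩
    obtain ⟨j, hj, hij⟩ := hD.congr hy i hi
    exact ⟨j, hj, hij.symm⟩
  exact ⟨fun h => by simpa [y.partner_partner] using key _ h, key v⟩

omit [CommMonoid G] in
theorem edge_mem_iff (v : BrauerNode n) :
    y.edge v ∈ y.edge '' (Sum.inl '' D) ↔ v ∈ (Sum.inl '' D : Set (BrauerNode n)) := by
  constructor
  · rintro ⟨w, hw, hvw⟩
    rcases (y.edge_eq_iff _ _).1 hvw with rfl | rfl
    · exact hw
    · exact (partner_mem_iff hD hy v).1 hw
  · exact fun h => ⟨v, h, rfl⟩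

theorem outer_cupCap_partner (v : BrauerNode n) :
    outer (cupCap x D hD) y (y.partner v) = outer (cupCap x D hD) y v := by
  by_cases hv : v ∈ (Sum.inl '' D : Set (BrauerNode n))
  · obtain ⟨i, hi, rfl⟩ := hv
    obtain ⟨j, hj, hij⟩ := hD.congr hy i hi
    rw [hij]
    change Quot.mk _ (Sum.inl ((cupCap x D hD).edge (.inl j))) =
      Quot.mk _ (Sum.inl ((cupCap x D hD).edge (.inl i)))
    rw [← hij, (hy i hi).1, ← cupCap_partner_inl_of_mem hD hi, edge_partner]
  · rw [outer_cupCap_of_notMem hD hv,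
      outer_cupCap_of_notMem hD (fun h => hv ((partner_mem_iff hD hy v).1 h)), edge_partner]

open Classical in
omit [CommMonoid G] hD hy in
/-- The edges of `y` at `D` close up to loops in the concatenation with `cupCap x D`; the other
edges survive. -/
noncomputable def survive (y : GBrauerDiagram G n) (D : Set (Fin n)) (f : y.Edge) :
    Option y.Edge :=
  if f ∈ y.edge '' (Sum.inl '' D) then none else some f

omit [CommMonoid G] in
theorem survive_of_mem {v : BrauerNode n} (hv : v ∈ (Sum.inl '' D : Set (BrauerNode n))) :
    survive y D (y.edge v) = none := if_pos ((edge_mem_iff hD hy v).2 hv)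

omit [CommMonoid G] in
theorem survive_of_notMem {v : BrauerNode n} (hv : v ∉ (Sum.inl '' D : Set (BrauerNode n))) :
    survive y D (y.edge v) = some (y.edge v) := if_neg fun h => hv ((edge_mem_iff hD hy v).1 h)

/-- The edge of `y` that an edge of `cupCap x D` contributes to in the composite. -/
noncomputable def cupCapEdgeMap : (cupCap x D hD).Edge → Option y.Edge :=
  Quotient.lift (Sum.elim (fun i => some (y.edge (.inl i))) (fun i => survive y D (y.edge (.inl i))))
    (by
      have key : ∀ v, Sum.elim (fun i => some (y.edge (.inl i)))
          (fun i => survive y D (y.edge (.inl i))) ((cupCap x D hD).partner v) =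
          Sum.elim (fun i => some (y.edge (.inl i))) (fun i => survive y D (y.edge (.inl i))) v := by
        rintro (i | i) <;> by_cases hi : i ∈ D
        · obtain ⟨j, hj, hij⟩ := hD.congr hy i hi
          rw [cupCap_partner_inl_of_mem hD hi, ← (hy i hi).1, hij, Sum.elim_inl, Sum.elim_inl,
            ← hij, edge_partner]
        · rw [cupCap_partner_inl_of_notMem hD hi, Sum.elim_inl, Sum.elim_inr]
          exact survive_of_notMem hD hy (by simpa using hi)
        · obtain ⟨j, hj, hij⟩ := hD.congr hy i hi
          rw [cupCap_partner_inr_of_mem hD hi, ← (hy i hi).1, hij, Sum.swap_inl, Sum.elim_inr,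
            Sum.elim_inr, ← hij, edge_partner]
        · rw [cupCap_partner_inr_of_notMem hD hi, Sum.elim_inl, Sum.elim_inr]
          exact (survive_of_notMem hD hy (by simpa using hi)).symm
      rintro u v (rfl | rfl)
      · rfl
      · exact key v)

/-- The edge of `y` that survives in a component of the concatenation of `cupCap x D` and `y`. -/
noncomputable def cupCapComponentMap : Component (cupCap x D hD) y → Option y.Edge :=
  Quot.lift (Sum.elim (cupCapEdgeMap hD hy) (survive y D)) (by rintro _ _ ⟨i⟩; rfl)

theorem cupCapComponentMap_outer (v : BrauerNode n) :
    cupCapComponentMap hD hy (outer (cupCap x D hD) y v) = some (y.edge v) := by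
  rcases v with i | i
  · rfl
  · exact survive_of_notMem hD hy (by simp)

theorem outer_cupCap_eq_iff (u v : BrauerNode n) :
    outer (cupCap x D hD) y u = outer (cupCap x D hD) y v ↔ u = v ∨ u = y.partner v := by
  constructor
  · intro h
    have := congrArg (cupCapComponentMap hD hy) h
    rw [cupCapComponentMap_outer, cupCapComponentMap_outer] at this
    exact (y.edge_eq_iff _ _).1 (Option.some_injective _ this)
  · rintro (rfl | rfl)
    · rfl
    · exact outer_cupCap_partner hD hy v

theorem cupCapComponentMap_eq_some (c : Component (cupCap x D hD) y) (v : BrauerNode n) :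
    c = outer (cupCap x D hD) y v ↔ cupCapComponentMap hD hy c = some (y.edge v) := by
  constructor
  · rintro rfl
    exact cupCapComponentMap_outer hD hy v
  · intro h
    -- a component with a surviving edge contains an outer node
    obtain ⟨u, rfl⟩ : ∃ u, c = outer (cupCap x D hD) y u := by
      obtain ⟨e | e, rfl⟩ := Quot.mk_surjective c
      · obtain ⟨i | i, rfl⟩ := edge_surjective _ e
        · exact ⟨.inl i, rfl⟩
        · by_cases hi : i ∈ D
          · have h' : survive y D (y.edge (.inl i)) = some (y.edge v) := h
            rw [survive_of_mem hD hy ⟨i, hi, rfl⟩] at h'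
            cases h'
          · rw [cupCap_edge_inr hD hi]
            exact ⟨.inl i, rfl⟩
      · obtain ⟨w, rfl⟩ := edge_surjective _ e
        by_cases hw : w ∈ (Sum.inl '' D : Set (BrauerNode n))
        · have h' : survive y D (y.edge w) = some (y.edge v) := h
          rw [survive_of_mem hD hy hw] at h'
          cases h'
        · exact ⟨w, (outer_cupCap_of_notMem hD hw).symm⟩
    rw [cupCapComponentMap_outer] at h
    exact (outer_cupCap_eq_iff hD hy u v).2 ((y.edge_eq_iff _ _).1 (Option.some_injective _ h))

theorem componentLabel_cupCap (v : BrauerNode n) :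
    componentLabel (cupCap x D hD) y (outer (cupCap x D hD) y v) = y.label v := by
  have h1 : componentLabel (cupCap x D hD) y (outer (cupCap x D hD) y v) =
      fibreProd (Sum.elim (cupCapEdgeMap hD hy) (survive y D))
        (Sum.elim (cupCap x D hD).edgeLabel y.edgeLabel) (some (y.edge v)) :=
    fibreProd_congr (Equiv.refl _) _ _
      (fun e => cupCapComponentMap_eq_some hD hy (Quot.mk _ e) v) (fun e => rfl)
  rw [h1, fibreProd_sum]
  simp only [Sum.elim_inl, Sum.elim_inr]
  by_cases hv : v ∈ (Sum.inl '' D : Set (BrauerNode n))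
  · -- the component is the single arc of `cupCap x D` at `v`
    rw [fibreProd_of_isEmpty (survive y D), mul_one]
    · obtain ⟨i, hi, rfl⟩ := hv
      refine (fibreProd_eq_of_unique (cupCapEdgeMap hD hy) (cupCap x D hD).edgeLabel _
        ((cupCap x D hD).edge (.inl i)) rfl ?_).trans ?_
      · intro e he
        obtain ⟨i' | i', rfl⟩ := edge_surjective _ e
        · have h := (y.edge_eq_iff _ _).1 (Option.some_injective _ he)
          rw [(hy i hi).1, ← cupCap_partner_inl_of_mem hD hi] at h
          exact (edge_eq_iff _ _ _).2 h
        · have he' : survive y D (y.edge (.inl i')) = some (y.edge (.inl i)) := he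
          by_cases hi' : i' ∈ D
          · rw [survive_of_mem hD hy ⟨i', hi', rfl⟩] at he'
            cases he'
          · rw [survive_of_notMem hD hy (by simpa using hi')] at he'
            have h := (edge_mem_iff hD hy (.inl i)).2 ⟨i, hi, rfl⟩
            rw [← Option.some_injective _ he', edge_mem_iff hD hy] at h
            exact absurd h (by simpa using hi')
      · rw [edgeLabel_edge, cupCap_label_inl_of_mem hD hi, (hy i hi).2]
    · intro f hf
      unfold survive at hf
      split_ifs at hf with hfD
      rw [Option.some_injective _ hf, edge_mem_iff hD hy] at hfD
      exact hfD hv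
  · -- besides the edge of `y` the component only has horizontal edges, with trivial labels
    rw [fibreProd_eq_one (cupCapEdgeMap hD hy), one_mul,
      fibreProd_eq_of_unique _ _ _ (y.edge v) (survive_of_notMem hD hy hv), edgeLabel_edge]
    · intro f hf
      unfold survive at hf
      split_ifs at hf with hfD
      exact Option.some_injective _ hf
    · intro e he
      obtain ⟨i | i, rfl⟩ := edge_surjective _ e
      · by_cases hi : i ∈ D
        · have h := (edge_mem_iff hD hy (.inl i)).2 ⟨i, hi, rfl⟩
          rw [Option.some_injective _ (show some (y.edge (.inl i)) = some (y.edge v) from he),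
            edge_mem_iff hD hy] at h
          exact absurd h hv
        · exact cupCap_label_inl_of_notMem hD hi
      · rfl

theorem cupCap_mul : cupCap x D hD * y = y :=
  eq_mul_of _ _ _ (outer_cupCap_eq_iff hD hy) (componentLabel_cupCap hD hy)

end CupCap

theorem isUnit_loopFactor {k : Type*} [CommRing k] [MulSemiringAction G k] {δ : k}
    (hδ : IsUnit δ) (x y : GBrauerDiagram G n) : IsUnit (loopFactor δ x y) :=
  finprod_induction IsUnit isUnit_one (fun _ _ => IsUnit.mul) fun c =>
    hδ.map (MulSemiringAction.toRingHom G k (componentLabel x y c.1))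

/-- The loop factor of `cupCap x D` and `y` is the same for all `y` in the cone: this follows
from associativity and `cupCap x D * y = y`, as loop factors are units. -/
theorem loopFactor_cupCap {k : Type*} [CommRing k] [MulSemiringAction G k] {δ : k}
    (hδ : IsUnit δ) {x y : GBrauerDiagram G n} {D : Set (Fin n)} (hD : IsLeftClosed x D)
    (hy : y ∈ leftCone x D) :
    loopFactor δ (cupCap x D hD) y = loopFactor δ (cupCap x D hD) (cupCap x D hD) := by
  have h := loopFactor_assoc δ (cupCap x D hD) (cupCap x D hD) y
  rw [cupCap_mul hD hy, cupCap_mul hD (cupCap_mem_leftCone hD)] at h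
  exact ((isUnit_loopFactor hδ _ _).mul_left_cancel h).symm

end LeftCone

end GBrauerDiagram

/-! ### Diagrams without left-to-left and right-to-right connections -/

namespace GBrauerDiagram

section ThroughDiagram

variable {G : Type u} [CommGroup G] {n : ℕ}

/-- The diagram of an element `(f, σ)` of `G^n ⋊ Σ_n`: the `i`-th left-hand node is joined to the
`σ⁻¹ i`-th right-hand node by an edge with label `f i`. -/
def ofWreath (w : PermWreath G n) : GBrauerDiagram G n where
  partner := Sum.elim (fun i => .inr (w.right⁻¹ i)) (fun j => .inl (w.right j))
  label := Sum.elim w.left (fun j => w.left (w.right j))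
  partner_partner := by rintro (i | i) <;> simp
  partner_ne := by rintro (i | i) h <;> cases h
  label_partner := by rintro (i | i) <;> simp

theorem ofWreath_partner_inl (w : PermWreath G n) (i : Fin n) :
    (ofWreath w).partner (.inl i) = .inr (w.right⁻¹ i) := rfl

theorem ofWreath_partner_inr (w : PermWreath G n) (i : Fin n) :
    (ofWreath w).partner (.inr i) = .inl (w.right i) := rfl

theorem isThrough_ofWreath (w : PermWreath G n) : (ofWreath w).IsThrough :=
  ⟨fun i j h => (by cases h), fun i j h => (by cases h)⟩

theorem ofWreath_injective : Function.Injective (ofWreath : PermWreath G n → GBrauerDiagram G n) := by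
  intro w w' h
  have hr : w.right = w'.right := by
    ext1 i
    have := congrArg (fun x => x.partner (.inr i)) h
    exact Sum.inl_injective this
  refine SemidirectProduct.ext (funext fun i => ?_) hr
  exact congrArg (fun x => x.label (.inl i)) h

theorem exists_ofWreath_eq {x : GBrauerDiagram G n} (hx : x.IsThrough) :
    ∃ w, ofWreath w = x := by
  have h : ∀ i, ∃ j, x.partner (.inl i) = .inr j := fun i => by
    rcases hi : x.partner (.inl i) with j | j
    · exact absurd hi (hx.1 i j)
    · exact ⟨j, rfl⟩
  choose f hf using h
  have hinj : Function.Injective f := fun i i' hii => by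
    have := congrArg x.partner ((hf i).trans ((congrArg Sum.inr hii).trans (hf i').symm))
    rw [x.partner_partner, x.partner_partner] at this
    exact Sum.inl_injective this
  let τ : Equiv.Perm (Fin n) := Equiv.ofBijective f (Finite.injective_iff_bijective.1 hinj)
  have hτ (j) : x.partner (.inr j) = .inl (τ⁻¹ j) := by
    obtain ⟨i, rfl⟩ := τ.surjective j
    rw [show τ⁻¹ (τ i) = i from τ.symm_apply_apply i]
    change x.partner (.inr (f i)) = _
    rw [← hf, x.partner_partner]
  refine ⟨⟨fun i => x.label (.inl i), τ⁻¹⟩, GBrauerDiagram.ext (funext ?_) (funext ?_)⟩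
  · rintro (i | i)
    · rw [hf, ofWreath_partner_inl, inv_inv]
      rfl
    · rw [hτ, ofWreath_partner_inr]
  · rintro (i | i)
    · rfl
    · change x.label (.inl (τ⁻¹ i)) = _
      rw [← hτ, x.label_partner]

/-- The left-hand node at which an edge of the diagram of `w` starts. -/
def ofWreathEdgeStart (w : PermWreath G n) : (ofWreath w).Edge → Fin n :=
  Quotient.lift (Sum.elim id w.right) (by
    rintro u v (rfl | rfl)
    · rfl
    · rcases v with i | i <;> simp [ofWreath_partner_inl, ofWreath_partner_inr])

theorem ofWreathEdgeStart_eq (w : PermWreath G n) (e : (ofWreath w).Edge) (i : Fin n) :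
    ofWreathEdgeStart w e = i ↔ e = (ofWreath w).edge (.inl i) := by
  constructor
  · rintro rfl
    obtain ⟨j | j, rfl⟩ := edge_surjective _ e
    · rfl
    · exact ((ofWreath w).edge_eq_iff _ _).2 (Or.inr (by simp [ofWreathEdgeStart, edge,
        ofWreath_partner_inl]))
  · rintro rfl
    rfl

/-- The left-hand node at which a component of the concatenation starts. -/
def ofWreathComponentStart (w w' : PermWreath G n) :
    Component (ofWreath w) (ofWreath w') → Fin n :=
  Quot.lift (Sum.elim (ofWreathEdgeStart w) (fun e => w.right (ofWreathEdgeStart w' e)))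
    (by rintro _ _ ⟨i⟩; rfl)

theorem ofWreathComponentStart_eq (w w' : PermWreath G n)
    (c : Component (ofWreath w) (ofWreath w')) (i : Fin n) :
    c = outer _ _ (.inl i) ↔ ofWreathComponentStart w w' c = i := by
  constructor
  · rintro rfl
    rfl
  · rintro rfl
    obtain ⟨e | e, rfl⟩ := Quot.mk_surjective c
    · exact congrArg (fun e => Quot.mk _ (Sum.inl e)) ((ofWreathEdgeStart_eq w e _).1 rfl)
    · have h1 := (ofWreathEdgeStart_eq w' e _).1 rfl
      have h2 : (ofWreath w).edge (.inr (ofWreathEdgeStart w' e)) =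
          (ofWreath w).edge (.inl (w.right (ofWreathEdgeStart w' e))) :=
        (ofWreathEdgeStart_eq w _ _).1 rfl
      change Quot.mk _ (Sum.inr e) =
        Quot.mk _ (Sum.inl ((ofWreath w).edge (.inl (w.right (ofWreathEdgeStart w' e)))))
      rw [← h2]
      refine Eq.trans ?_ (Quot.sound (Joined.middle _)).symm
      exact congrArg (fun e => Quot.mk _ (Sum.inr e)) h1

theorem ofWreath_mul (w w' : PermWreath G n) :
    ofWreath w * ofWreath w' = ofWreath (w * w') := by
  have hinr (j : Fin n) : outer (ofWreath w) (ofWreath w') (.inr j) =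
      outer (ofWreath w) (ofWreath w') (.inl ((w * w').right j)) :=
    (ofWreathComponentStart_eq w w' _ _).2 rfl
  have hinl (i j : Fin n) : outer (ofWreath w) (ofWreath w') (.inl i) =
      outer (ofWreath w) (ofWreath w') (.inl j) ↔ i = j :=
    (ofWreathComponentStart_eq w w' _ _)
  have hlab (i : Fin n) : componentLabel (ofWreath w) (ofWreath w') (outer _ _ (.inl i)) =
      (ofWreath (w * w')).label (.inl i) := by
    have h1 : componentLabel (ofWreath w) (ofWreath w') (outer _ _ (.inl i)) =
        fibreProd (Sum.elim (ofWreathEdgeStart w) (fun e => w.right (ofWreathEdgeStart w' e)))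
          (Sum.elim (ofWreath w).edgeLabel (ofWreath w').edgeLabel) i :=
      fibreProd_congr (Equiv.refl _) _ _
        (fun e => ofWreathComponentStart_eq w w' (Quot.mk _ e) i) (fun e => rfl)
    rw [h1, fibreProd_sum]
    simp only [Sum.elim_inl, Sum.elim_inr]
    refine (congrArg₂ (· * ·)
      (fibreProd_eq_of_unique (ofWreathEdgeStart w) (ofWreath w).edgeLabel i
        ((ofWreath w).edge (.inl i)) rfl fun e he => (ofWreathEdgeStart_eq w e i).1 he)
      (fibreProd_eq_of_unique (fun e => w.right (ofWreathEdgeStart w' e)) (ofWreath w').edgeLabel i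
        ((ofWreath w').edge (.inl (w.right⁻¹ i))) (w.right.apply_symm_apply i)
        fun e he => (ofWreathEdgeStart_eq w' e _).1 (by simp [← he]))).trans ?_
    rfl
  refine eq_mul_of _ _ _ ?_ ?_
  · rintro (i | i) (j | j)
    · rw [hinl, ofWreath_partner_inl]
      simp
    · rw [hinr, hinl, ofWreath_partner_inr]
      simp
    · rw [hinr, hinl, ofWreath_partner_inl]
      simp [Equiv.eq_symm_apply]
    · rw [hinr, hinr, hinl, ofWreath_partner_inr]
      simp
  · rintro (i | i)
    · exact hlab i
    · rw [hinr, hlab]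
      rfl

theorem ofWreath_one : ofWreath (1 : PermWreath G n) = 1 := by
  refine GBrauerDiagram.ext (funext ?_) (funext ?_)
  · rintro (i | i) <;> rfl
  · rintro (i | i) <;> rfl

end ThroughDiagram

end GBrauerDiagram

/-! ### Spans of diagrams -/

namespace GBrauerAlgebra

section Span

variable {G : Type u} {n : ℕ} {k : Type u} [CommRing k] {δ : k}

/-- The span of a set of diagrams in the `G`-Brauer algebra. -/
noncomputable def spanOf (G : Type u) (n : ℕ) {k : Type u} [CommRing k] (δ : k) (T : Set (GBrauerDiagram G n)) :
    AddSubgroup (GBrauerAlgebra G n k δ) :=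
  (Finsupp.supported k k T).toAddSubgroup

theorem single_mem_spanOf {T : Set (GBrauerDiagram G n)} {x : GBrauerDiagram G n} (hx : x ∈ T)
    (a : k) : single x a ∈ spanOf G n δ T :=
  Finsupp.single_mem_supported k a hx

theorem spanOf_mono {S T : Set (GBrauerDiagram G n)} (h : S ⊆ T) :
    spanOf G n δ S ≤ spanOf G n δ T :=
  Finsupp.supported_mono (R := k) (M := k) h

theorem spanOf_empty : spanOf G n δ (∅ : Set (GBrauerDiagram G n)) = ⊥ := by
  rw [spanOf, Finsupp.supported_empty]
  rfl

theorem spanOf_inter (S T : Set (GBrauerDiagram G n)) :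
    spanOf G n δ (S ∩ T) = spanOf G n δ S ⊓ spanOf G n δ T := by
  rw [spanOf, Finsupp.supported_inter]
  rfl

theorem spanOf_union (S T : Set (GBrauerDiagram G n)) :
    spanOf G n δ (S ∪ T) = spanOf G n δ S ⊔ spanOf G n δ T := by
  rw [spanOf, Finsupp.supported_union, Submodule.sup_toAddSubgroup]
  rfl

/-- An element lies in the span of its support. -/
theorem exists_finite_mem_spanOf {T : Set (GBrauerDiagram G n)} {f : GBrauerAlgebra G n k δ}
    (hf : f ∈ spanOf G n δ T) :
    ∃ F : Finset (GBrauerDiagram G n), ↑F ⊆ T ∧ f ∈ spanOf G n δ (F : Set (GBrauerDiagram G n)) :=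
  ⟨Finsupp.support f, hf, (Finsupp.mem_supported k f).2 subset_rfl⟩

theorem spanOf_le {T : Set (GBrauerDiagram G n)} {S : AddSubgroup (GBrauerAlgebra G n k δ)}
    (h : ∀ x ∈ T, ∀ a : k, single x a ∈ S) : spanOf G n δ T ≤ S := by
  intro f hf
  rw [← show Finsupp.sum f single = f from Finsupp.sum_single f]
  exact AddSubgroup.sum_mem _ fun x hx => h x (hf hx) _

end Span

end GBrauerAlgebra

/-! ### The quotient map to the group algebra -/

namespace GBrauerAlgebra

variable {G : Type u} [CommGroup G] {n : ℕ} {k : Type u} [CommRing k] {δ : k}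
  [MulSemiringAction G k]

open GBrauerDiagram

/-- The inclusion of the group algebra of `G^n ⋊ Σ_n` into the `G`-Brauer algebra. -/
noncomputable def ofGroupAlgebra (G : Type u) [CommGroup G] (n : ℕ) {k : Type u} [CommRing k]
    (δ : k) [MulSemiringAction G k] :
    MonoidAlgebra k (PermWreath G n) →ₐ[k] GBrauerAlgebra G n k δ :=
  MonoidAlgebra.lift k (GBrauerAlgebra G n k δ) (PermWreath G n)
    { toFun := fun w => single (ofWreath w) 1
      map_one' := by rw [ofWreath_one, one_def]
      map_mul' := fun w w' => by
        rw [single_mul_single, ofWreath_mul, loopFactor_of_isThrough δ _ _ (isThrough_ofWreath w)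
          (isThrough_ofWreath w'), mul_one, mul_one] }

theorem ofGroupAlgebra_single (w : PermWreath G n) (a : k) :
    ofGroupAlgebra G n δ (MonoidAlgebra.single w a) = single (ofWreath w) a := by
  rw [ofGroupAlgebra, MonoidAlgebra.lift_single]
  change a • single (ofWreath w) 1 = _
  rw [smul_single, mul_one]

open Classical in
/-- The linear map to the group algebra of `G^n ⋊ Σ_n` that kills all diagrams with left-to-left
or right-to-right connections. -/
noncomputable def throughPartLinear (G : Type u) [CommGroup G] (n : ℕ) {k : Type u} [CommRing k]
    (δ : k) : GBrauerAlgebra G n k δ →ₗ[k] MonoidAlgebra k (PermWreath G n) :=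
  Finsupp.linearCombination k fun x : GBrauerDiagram G n =>
    if h : ∃ w, ofWreath w = x then MonoidAlgebra.single h.choose 1 else 0

omit [MulSemiringAction G k] in
theorem throughPartLinear_ofWreath (w : PermWreath G n) (a : k) :
    throughPartLinear G n δ (single (ofWreath w) a) = MonoidAlgebra.single w a := by
  have h : ∃ w', ofWreath w' = ofWreath w := ⟨w, rfl⟩
  refine (Finsupp.linearCombination_single k a (ofWreath w)).trans ?_
  rw [dif_pos h, ofWreath_injective h.choose_spec, MonoidAlgebra.smul_single, smul_eq_mul, mul_one]

omit [MulSemiringAction G k] in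
theorem throughPartLinear_of_not_isThrough {x : GBrauerDiagram G n} (hx : ¬ x.IsThrough) (a : k) :
    throughPartLinear G n δ (single x a) = 0 := by
  have h : ¬ ∃ w, ofWreath w = x := by
    rintro ⟨w, rfl⟩
    exact hx (isThrough_ofWreath w)
  refine (Finsupp.linearCombination_single k a x).trans ?_
  rw [dif_neg h, smul_zero]

/-- The quotient map from the `G`-Brauer algebra to the group algebra of `G^n ⋊ Σ_n`. -/
noncomputable def throughPart (G : Type u) [CommGroup G] (n : ℕ) {k : Type u} [CommRing k]
    (δ : k) [MulSemiringAction G k] :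
    GBrauerAlgebra G n k δ →ₐ[k] MonoidAlgebra k (PermWreath G n) :=
  AlgHom.ofLinearMap (throughPartLinear G n δ)
    (by rw [one_def, ← ofWreath_one, throughPartLinear_ofWreath]; rfl)
    (by
      intro f g
      induction f using induction with
      | h0 => rw [zero_mul, map_zero, zero_mul]
      | hadd f f' hf hf' => rw [add_mul, map_add, map_add, add_mul, hf, hf']
      | hs x a =>
        induction g using induction with
        | h0 => rw [mul_zero, map_zero, mul_zero]
        | hadd g g' hg hg' => rw [mul_add, map_add, map_add, mul_add, hg, hg']
        | hs y b =>
          rw [single_mul_single]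
          by_cases hx : x.IsThrough
          · by_cases hy : y.IsThrough
            · rw [loopFactor_of_isThrough δ x y hx hy]
              obtain ⟨w, rfl⟩ := exists_ofWreath_eq hx
              obtain ⟨w', rfl⟩ := exists_ofWreath_eq hy
              rw [ofWreath_mul, throughPartLinear_ofWreath, throughPartLinear_ofWreath,
                throughPartLinear_ofWreath, MonoidAlgebra.single_mul_single, mul_one]
            · rw [throughPartLinear_of_not_isThrough hy, mul_zero,
                throughPartLinear_of_not_isThrough fun h => hy ((isThrough_mul_iff x y).1 h).2]
          · rw [throughPartLinear_of_not_isThrough hx, zero_mul,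
              throughPartLinear_of_not_isThrough fun h => hx ((isThrough_mul_iff x y).1 h).1])

theorem throughPart_ofWreath (w : PermWreath G n) (a : k) :
    throughPart G n δ (single (ofWreath w) a) = MonoidAlgebra.single w a :=
  throughPartLinear_ofWreath w a

theorem throughPart_of_not_isThrough {x : GBrauerDiagram G n} (hx : ¬ x.IsThrough) (a : k) :
    throughPart G n δ (single x a) = 0 := throughPartLinear_of_not_isThrough hx a

theorem throughPart_ofGroupAlgebra (b : MonoidAlgebra k (PermWreath G n)) :
    throughPart G n δ (ofGroupAlgebra G n δ b) = b := by
  induction b using MonoidAlgebra.induction_linear with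
  | zero => rw [map_zero, map_zero]
  | add a b ha hb => rw [map_add, map_add, ha, hb]
  | single w a => rw [ofGroupAlgebra_single, throughPart_ofWreath]

theorem augmentation_eq_comp :
    augmentation G n δ = (groupAlgebraAugmentation k (PermWreath G n)).comp (throughPart G n δ) := by
  refine AlgHom.ext fun f => ?_
  induction f using induction with
  | h0 => rw [map_zero, map_zero]
  | hadd f g hf hg => rw [map_add, map_add, hf, hg]
  | hs x a =>
    refine (augmentationLinear_single x a).trans ?_
    rw [AlgHom.comp_apply]
    by_cases hx : x.IsThrough
    · obtain ⟨w, rfl⟩ := exists_ofWreath_eq hx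
      rw [if_pos hx, throughPart_ofWreath, groupAlgebraAugmentation_single]
    · rw [if_neg hx, throughPart_of_not_isThrough hx, map_zero]

theorem isRightIdeal_spanOf {T : Set (GBrauerDiagram G n)} (h : ∀ x ∈ T, ∀ y, x * y ∈ T) :
    IsRightIdeal (spanOf G n δ T) := by
  intro j hj f
  induction f using induction with
  | h0 => rw [mul_zero]; exact zero_mem _
  | hadd f g hf hg => rw [mul_add]; exact add_mem hf hg
  | hs y b =>
    have : spanOf G n δ T ≤ (spanOf G n δ T).comap (AddMonoidHom.mulRight (single y b)) :=
      spanOf_le fun x hx a => by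
        change single x a * single y b ∈ spanOf G n δ T
        rw [single_mul_single]
        exact single_mem_spanOf (h x hx y) _
    exact this hj

/-- The kernel of the quotient map to the group algebra is spanned by the diagrams with
left-to-left or right-to-right connections. -/
theorem ker_throughPart :
    (RingHom.ker (throughPart G n δ).toRingHom).toAddSubgroup =
      spanOf G n δ {x : GBrauerDiagram G n | ¬ x.IsThrough} := by
  apply le_antisymm
  · intro f hf
    have key : ∀ f : GBrauerAlgebra G n k δ,
        f - ofGroupAlgebra G n δ (throughPart G n δ f) ∈
          spanOf G n δ {x : GBrauerDiagram G n | ¬ x.IsThrough} := by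
      intro f
      induction f using induction with
      | h0 => rw [map_zero, map_zero, sub_zero]; exact zero_mem _
      | hadd f g hf hg =>
        rw [map_add, map_add, add_sub_add_comm]
        exact add_mem hf hg
      | hs x a =>
        by_cases hx : x.IsThrough
        · obtain ⟨w, rfl⟩ := exists_ofWreath_eq hx
          rw [throughPart_ofWreath, ofGroupAlgebra_single, sub_self]
          exact zero_mem _
        · rw [throughPart_of_not_isThrough hx, map_zero, sub_zero]
          exact single_mem_spanOf hx a
    have h := key f
    rw [show throughPart G n δ f = 0 from hf, map_zero, sub_zero] at h
    exact h
  · exact spanOf_le fun x hx a => throughPart_of_not_isThrough hx a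

end GBrauerAlgebra

/-! ### Exactness of `I · P` for the `G`-Brauer algebra -/

namespace GBrauerAlgebra

open GBrauerDiagram

theorem foldr_union_append {D : Type*} (l l' : List (Set D)) :
    (l ++ l').foldr (· ∪ ·) ∅ = l.foldr (· ∪ ·) ∅ ∪ l'.foldr (· ∪ ·) ∅ := by
  induction l with
  | nil => simp
  | cons S l ih => simp only [List.cons_append, List.foldr_cons, ih, Set.union_assoc]

section Exactness

variable {G : Type u} {n : ℕ}

/-- The cones of the diagrams that contain a prescribed nonempty set of labelled left-hand arcs,
together with the empty set: a family of sets of diagrams that is closed under intersection. -/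
def leftCones (G : Type u) (n : ℕ) : Set (Set (GBrauerDiagram G n)) :=
  {T | T = ∅ ∨ ∃ x D, IsLeftClosed x D ∧ D.Nonempty ∧ T = leftCone x D}

theorem inter_mem_leftCones {S T : Set (GBrauerDiagram G n)} (hS : S ∈ leftCones G n)
    (hT : T ∈ leftCones G n) : S ∩ T ∈ leftCones G n := by
  rcases hS with rfl | ⟨x, D, hD, hne, rfl⟩
  · exact Or.inl (Set.empty_inter _)
  rcases hT with rfl | ⟨x', D', hD', -, rfl⟩
  · exact Or.inl (Set.inter_empty _)
  rcases Set.eq_empty_or_nonempty (leftCone x D ∩ leftCone x' D') with h | ⟨y, hy, hy'⟩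
  · exact Or.inl h
  · exact Or.inr ⟨y, D ∪ D', (hD.congr hy).union (hD'.congr hy'), hne.mono Set.subset_union_left,
      leftCone_inter hy hy'⟩

theorem not_isThrough_of_mem_leftCone {x y : GBrauerDiagram G n} {D : Set (Fin n)}
    (hD : IsLeftClosed x D) (hne : D.Nonempty) (hy : y ∈ leftCone x D) : ¬ y.IsThrough := by
  obtain ⟨i, hi⟩ := hne
  obtain ⟨j, -, hij⟩ := hD.congr hy i hi
  exact fun h => h.1 i j hij

theorem subset_of_mem_leftCones {T : Set (GBrauerDiagram G n)} (hT : T ∈ leftCones G n) :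
    T ⊆ {x : GBrauerDiagram G n | ¬ x.IsThrough} := by
  rcases hT with rfl | ⟨x, D, hD, hne, rfl⟩
  · exact Set.empty_subset _
  · exact fun y hy => not_isThrough_of_mem_leftCone hD hne hy

theorem exists_mem_leftCones {x : GBrauerDiagram G n} (hx : ¬ x.IsThrough) :
    ∃ T ∈ leftCones G n, x ∈ T := by
  have h : ∃ i j, x.partner (.inl i) = .inl j := by
    by_contra! h
    exact hx (x.isThrough_of_left h)
  obtain ⟨i, j, hij⟩ := h
  refine ⟨_, Or.inr ⟨x, {i | ∃ j, x.partner (.inl i) = .inl j}, ?_, ⟨i, j, hij⟩, rfl⟩,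
    self_mem_leftCone x _⟩
  rintro i ⟨j, hij⟩
  exact ⟨j, ⟨i, by rw [← hij, x.partner_partner]⟩, hij⟩

theorem exists_list_leftCones (F : Finset (GBrauerDiagram G n))
    (hF : ∀ x ∈ F, ¬ x.IsThrough) :
    ∃ l : List (Set (GBrauerDiagram G n)), (∀ T ∈ l, T ∈ leftCones G n) ∧
      (F : Set (GBrauerDiagram G n)) ⊆ l.foldr (· ∪ ·) ∅ := by
  classical
  induction F using Finset.induction_on with
  | empty => exact ⟨[], by simp, by simp⟩
  | insert x F _ ih =>
    obtain ⟨l, hl, hFl⟩ := ih fun y hy => hF y (Finset.mem_insert_of_mem hy)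
    obtain ⟨T, hT, hxT⟩ := exists_mem_leftCones (hF x (Finset.mem_insert_self x F))
    refine ⟨T :: l, by simpa using ⟨hT, hl⟩, ?_⟩
    rw [Finset.coe_insert, List.foldr_cons]
    exact Set.insert_subset (Or.inl hxT) (hFl.trans Set.subset_union_right)

variable [CommGroup G] {k : Type u} [CommRing k] [MulSemiringAction G k] {δ : k}

theorem isRightIdeal_of_mem_leftCones {T : Set (GBrauerDiagram G n)} (hT : T ∈ leftCones G n) :
    IsRightIdeal (spanOf G n δ T) := by
  refine isRightIdeal_spanOf fun y hy z => ?_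
  rcases hT with rfl | ⟨x, D, hD, -, rfl⟩
  · exact hy.elim
  · exact mul_mem_leftCone hD hy z

variable {ε : MonoidAlgebra k (PermWreath G n) →ₐ[k] k}
  (P : ProjectiveResolution (ModuleCat.of (GBrauerAlgebra G n k δ)
    (TrivialModule (ε.comp (throughPart G n δ)))))

/-- The span of a cone is generated by an idempotent multiple of `cupCap x D`. -/
theorem isAcyclicOn_of_mem_leftCones (hδ : IsUnit δ) {T : Set (GBrauerDiagram G n)}
    (hT : T ∈ leftCones G n) : IsAcyclicOn P.complex (spanOf G n δ T) := by
  rcases hT with rfl | ⟨x, D, hD, hne, rfl⟩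
  · rw [spanOf_empty]
    exact isAcyclicOn_bot _
  obtain ⟨c, hc⟩ := (isUnit_loopFactor hδ (cupCap x D hD) (cupCap x D hD)).exists_left_inv
  refine isAcyclicOn_of_idempotent P (single (cupCap x D hD) c) (fun j hj => ?_) (fun f => ?_)
    (fun z => ?_)
  · have : spanOf G n δ (leftCone x D) ≤
        (AddMonoidHom.mulLeft (single (cupCap x D hD) c)).eqLocus
          (AddMonoidHom.id (GBrauerAlgebra G n k δ)) :=
      spanOf_le fun y hy a => by
        change single (cupCap x D hD) c * single y a = single y a
        rw [single_mul_single, cupCap_mul hD hy, loopFactor_cupCap hδ hD hy, mul_right_comm, hc,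
          one_mul]
    exact this hj
  · exact isRightIdeal_spanOf (fun y hy z => mul_mem_leftCone hD hy z) _
      (single_mem_spanOf (cupCap_mem_leftCone hD) c) f
  · refine TrivialModule.smul_eq_zero (ε.comp (throughPart G n δ)) ?_ z
    rw [AlgHom.comp_apply, throughPart_of_not_isThrough
      (not_isThrough_of_mem_leftCone hD hne (cupCap_mem_leftCone hD)), map_zero]

/-- An element of `I · N` lies in `J · N` for the span `J` of a finite union of cones. -/
theorem exists_list_mem_idealMul {N : Type u} [AddCommGroup N] [Module (GBrauerAlgebra G n k δ) N]
    {z : N} (hz : z ∈ idealMul (spanOf G n δ {x : GBrauerDiagram G n | ¬ x.IsThrough}) N) :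
    ∃ l : List (Set (GBrauerDiagram G n)), (∀ T ∈ l, T ∈ leftCones G n) ∧
      z ∈ idealMul (spanOf G n δ (l.foldr (· ∪ ·) ∅)) N := by
  unfold idealMul at hz
  induction hz using AddSubgroup.closure_induction with
  | mem z hz =>
    obtain ⟨j, hj, x, rfl⟩ := hz
    obtain ⟨F, hF, hjF⟩ := exists_finite_mem_spanOf hj
    obtain ⟨l, hl, hFl⟩ := exists_list_leftCones F hF
    exact ⟨l, hl, smul_mem_idealMul (spanOf_mono hFl hjF) x⟩
  | zero => exact ⟨[], by simp, zero_mem _⟩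
  | add a b _ _ ha hb =>
    obtain ⟨l, hl, hal⟩ := ha
    obtain ⟨l', hl', hbl⟩ := hb
    refine ⟨l ++ l', fun T hT => (List.mem_append.1 hT).elim (hl T) (hl' T), ?_⟩
    rw [foldr_union_append]
    exact add_mem (idealMul_mono (spanOf_mono Set.subset_union_left) hal)
      (idealMul_mono (spanOf_mono Set.subset_union_right) hbl)
  | neg a _ ha =>
    obtain ⟨l, hl, hal⟩ := ha
    exact ⟨l, hl, neg_mem hal⟩

/-- For invertible `δ`, the ideal `I` spanned by the diagrams with left-to-left or right-to-right
connections makes `I · P` exact for every projective resolution `P` of the trivial module. -/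
theorem isAcyclicOn_ker_throughPart (hδ : IsUnit δ) :
    IsAcyclicOn P.complex (RingHom.ker (throughPart G n δ).toRingHom).toAddSubgroup := by
  have hproj (m : ℕ) : Module.Projective (GBrauerAlgebra G n k δ) (P.complex.X m) :=
    (IsProjective.iff_projective (R := GBrauerAlgebra G n k δ) (P.complex.X m)).2 (P.projective m)
  rw [ker_throughPart]
  refine isAcyclicOn_of_exhaust fun m z hz => ?_
  obtain ⟨l, hl, hzl⟩ := exists_list_mem_idealMul hz
  refine ⟨_, spanOf_mono ?_, (isAcyclicOn_foldr_union (spanOf G n δ) spanOf_empty spanOf_union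
    spanOf_inter hproj (leftCones G n) (fun S hS T hT => inter_mem_leftCones hS hT)
    (fun T hT => isRightIdeal_of_mem_leftCones hT)
    (fun T hT => isAcyclicOn_of_mem_leftCones P hδ hT) l.length l rfl hl).2, hzl⟩
  clear hzl
  induction l with
  | nil => exact Set.empty_subset _
  | cons T l ih =>
    exact Set.union_subset (subset_of_mem_leftCones (hl T (by simp)))
      (ih fun S hS => hl S (by simp [hS]))

end Exactness

end GBrauerAlgebra

/-! ### Comparison of `Tor` -/

/-- For trivial `G` the group `G^n ⋊ Σ_n` is the symmetric group. -/
def permWreathEquiv (G : Type u) [CommGroup G] [Subsingleton G] (n : ℕ) :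
    PermWreath G n ≃* ULift.{u} (Equiv.Perm (Fin n)) where
  toFun w := ⟨w.right⟩
  invFun σ := ⟨1, σ.down⟩
  left_inv _ := SemidirectProduct.ext (Subsingleton.elim _ _) rfl
  right_inv _ := rfl
  map_mul' _ _ := rfl

theorem torTrivial_groupAlgebra_iso_of_mulEquiv (k : Type u) [CommRing k] {H H' : Type u} [Group H]
    [Group H'] (e : H ≃* H') (i : ℕ) :
    Nonempty (torTrivial (groupAlgebraAugmentation k H) i ≅
      torTrivial (groupAlgebraAugmentation k H') i) := by
  have h : groupAlgebraAugmentation k H =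
      (groupAlgebraAugmentation k H').comp (MonoidAlgebra.domCongr k k e).toAlgHom := by
    refine AlgHom.ext fun a => ?_
    induction a using MonoidAlgebra.induction_linear with
    | zero => rw [map_zero, map_zero]
    | add a b ha hb => rw [map_add, map_add, ha, hb]
    | single x c =>
      rw [groupAlgebraAugmentation_single]
      refine Eq.symm ((congrArg (groupAlgebraAugmentation k H')
        (MonoidAlgebra.domCongr_single (R := k) e x c)).trans ?_)
      rw [groupAlgebraAugmentation_single]
  rw [h]
  exact torTrivial_iso_of_algEquiv (MonoidAlgebra.domCongr k k e) _ i

theorem torTrivial_augmentation_iso {G k : Type u} [CommGroup G] [CommRing k]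
    [MulSemiringAction G k] (n : ℕ) {δ : k} (hδ : IsUnit δ) (i : ℕ) :
    Nonempty (torTrivial (GBrauerAlgebra.augmentation G n δ) i ≅
      torTrivial (groupAlgebraAugmentation k (PermWreath G n)) i) := by
  rw [GBrauerAlgebra.augmentation_eq_comp]
  exact torTrivial_iso_of_isAcyclicOn (GBrauerAlgebra.throughPart G n δ)
    (GBrauerAlgebra.ofGroupAlgebra G n δ) _ GBrauerAlgebra.throughPart_ofGroupAlgebra
    (ProjectiveResolution.of _) (GBrauerAlgebra.isAcyclicOn_ker_throughPart _ hδ) i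

theorem mainTheorem1 {G k : Type u} [CommGroup G] [CommRing k] [MulSemiringAction G k]
    (n : ℕ) (δ : k) (hδ : IsUnit δ) (i : ℕ) :
    Nonempty (torTrivial (GBrauerAlgebra.augmentation G n δ) i ≅
        torTrivial (groupAlgebraAugmentation k (PermWreath G n)) i) ∧
      Nonempty (torTrivial (groupAlgebraAugmentation k (PermWreath G n)) i ≅
        groupHomology (Rep.trivial k (PermWreath G n) k) i) ∧
      (Subsingleton G →
        Nonempty (torTrivial (GBrauerAlgebra.augmentation G n δ) i ≅
          groupHomology (Rep.trivial k (ULift.{u} (Equiv.Perm (Fin n))) k) i)) := by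
  refine ⟨torTrivial_augmentation_iso n hδ i, torTrivial_iso_groupHomology i, fun _ => ?_⟩
  obtain ⟨e₁⟩ := torTrivial_augmentation_iso (G := G) n hδ i
  obtain ⟨e₂⟩ := torTrivial_groupAlgebra_iso_of_mulEquiv k (permWreathEquiv G n) i
  obtain ⟨e₃⟩ := torTrivial_iso_groupHomology (k := k) (H := ULift.{u} (Equiv.Perm (Fin n))) i
  exact ⟨e₁ ≪≫ e₂ ≪≫ e₃⟩
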